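/- **Setting.** Fix integers $A\ge 1$, $S\ge A$, $Q\ge A$. The numbers of packets $a[n]\in\{0,\dots,A\}$ arriving in successive timeslots form an irreducible Markov chain with transition probabilities $\gamma_{a,a'}$ and stationary law $\phi$; put $\alpha=\sum_{a} a\,\phi_a>0$. Transmitting $s\in\{0,\dots,S\}$ packets in a slot over the (AWGN) channel costs power $P(s)$, where $P(0)=0$ and $P$ is nondecreasing and convex on $\{0,\dots,S\}$. The queue length $q[n]\in\{0,\dots,Q\}$ evolves as $q[n+1]=q[n]-s[n]+a[n+1]$. A policy is a family $F=\{f_{q,a}^s\}$ of probabilities, $\sum_s f_{q,a}^s=1$, where $f_{q,a}^s$ is the probability of transmitting $s$ packets in state $(q,a)$, and $f_{q,a}^s=0$ unless $\max\{q-Q+A,0\}\le s\le\min\{q,S\}$. From an initial state $(q_0,a_0)$ its average power and delay are $$P_F=\lim_{N\to\infty}\frac1N\,\mathbb E\Big[\sum_{n=1}^N P(s[n])\Big],\qquad D_F=\lim_{N\to\infty}\frac1N\,\mathbb E\Big[\frac1\alpha\sum_{n=1}^N q[n]\Big].$$ Let $\mathcal G$ be the set of state-action frequencies, i.e. of all $x=\{x_{q,a}^s\}$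 with $x_{q,a}^s\ge0$, $\sum_{q,a,s} x_{q,a}^s=1$, $x_{q,a}^s=0$ unless $\max\{q-Q+A,0\}\le s\le\min\{q,S\}$, and $$\sum_{q,a,s}\gamma_{a,a'}\,x_{q,a}^s\,\mathbb 1_{\{q'=q-s+a'\}}=\sum_s x_{q',a'}^s\quad\text{for all } q',a'.$$ Let $\mathcal R=\{(\sum_{q,a,s} P(s)x_{q,a}^s,\ \tfrac1\alpha\sum_{q,a,s} q\,x_{q,a}^s): x\in\mathcal G\}$ be the set of obtainable power-delay pairs, and let the optimal delay-power tradeoff curve be $$\mathcal L=\{(P^*,D^*)\in\mathcal R:\ \forall (\bar P,\bar D)\in\mathcal R,\ P^*\le\bar P\text{ or }D^*\le\bar D\}.$$ **Theorem.** For every $(P^*,D^*)\in\mathcal L$ there are a policy $F^*=\{{f^*}_{q,a}^s\}$, integers (thresholds) $q(s,a)$ for $-1\le s\le S$ and $0\le a\le A$ with $$q(-1,a)=-1,\qquad 0\le q(0,a)\le q(1,a)\le\dots\le q(S,a)\le Q,$$ a rate $s^*\in\{0,\dots,S-1\}$ and an arrival number $a^*\in\{0,\dots,A\}$ such that $$\begin{cases}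 {f^*}_{q,a}^{s}=1, & q(s-1,a)<q\le q(s,a),\ a\ne a^*\text{ or }s\ne s^*,\\ {f^*}_{q,a}^{s}=1, & q(s-1,a)<q< q(s,a),\ a=a^*\text{ and }s=s^*,\\ {f^*}_{q,a}^{s}+{f^*}_{q,a}^{s+1}=1, & q=q(s,a),\ a=a^*\text{ and }s=s^*,\\ {f^*}_{q,a}^{s}=0, & \text{otherwise,} \end{cases}$$ so that the rate is deterministic in every state except possibly $(q(s^*,a^*),a^*)$, where the policy randomizes between $s^*$ and $s^*+1$; and $F^*$ attains $(P^*,D^*)$ in the following sense. 1. The Markov chain $(q[n],a[n])$ under $F^*$ has a stationary distribution $\pi$ with $\sum_{q,a,s}P(s)\,\pi(q,a){f^*}_{q,a}^s=P^*$ and $\frac1\alpha\sum_{q,a}q\,\pi(q,a)=D^*$. 2. If moreover $D^*$ is the least delay obtainable with power at most $P^*$ (that is, $D^*\le\bar D$ for all $(\bar P,\bar D)\in\mathcal R$ with $\bar P\le P^*$), then $P_{F^*}=P^*$ and $D_{F^*}=D^*$ from every initial state, and $F^*$ minimizes the average delay subject to average power at most $P^*$: any policy $F$ and any initial state with $P_F\le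 P^*$ have $D_F\ge D^*$. -/

import Mathlib

open Filter Topology
open scoped BigOperators Matrix

noncomputable section

/-- A single time-slotted link over an AWGN channel, fed by Markov arrivals. -/
structure Link where
  /-- maximal number of packets arriving in a slot -/
  A : ℕ
  /-- maximal number of packets transmitted in a slot -/
  S : ℕ
  /-- buffer size -/
  Q : ℕ
  A_pos : 0 < A
  A_le_S : A ≤ S
  A_le_Q : A ≤ Q
  /-- `γ a a'` is the probability of `a'` arrivals in the next slot, given `a` in this one -/
  γ : Matrix (Fin (A + 1)) (Fin (A + 1)) ℝ
  γ_stochastic : γ ∈ Matrix.rowStochastic ℝ (Fin (A + 1))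
  γ_irreducible : γ.IsIrreducible
  /-- the (unique) stationary law of the arrival chain -/
  φ : Fin (A + 1) → ℝ
  φ_mem : φ ∈ stdSimplex ℝ (Fin (A + 1))
  φ_stationary : φ ᵥ* γ = φ
  /-- `P s` is the power needed to transmit `s` packets in a slot; only `s ≤ S` matters -/
  P : ℕ → ℝ
  P_zero : P 0 = 0
  P_mono : MonotoneOn P (Set.Iic S)
  P_convex : ∀ s, s + 2 ≤ S → P (s + 1) - P s ≤ P (s + 2) - P (s + 1)

namespace Link

/-- Average number of arrivals per slot. -/
def α (L : Link) : ℝ := ∑ a : Fin (L.A + 1), ((a : ℕ) : ℝ) * L.φ a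

/-- `s` is a feasible rate at queue length `q`:
`max (q - Q + A) 0 ≤ s ≤ min q S`. -/
def Feasible (L : Link) (q s : ℕ) : Prop := q + L.A ≤ s + L.Q ∧ s ≤ q ∧ s ≤ L.S

/-- System states: (queue length, number of arrivals in the slot). -/
abbrev State (L : Link) : Type := Fin (L.Q + 1) × Fin (L.A + 1)

/-- A (randomized) transmission policy: `prob q a s` is the probability of rate `s` in the
state `(q, a)`; infeasible rates are not used. -/
structure Policy (L : Link) where
  prob : Fin (L.Q + 1) → Fin (L.A + 1) → Fin (L.S + 1) → ℝ
  nonneg : ∀ q a s, 0 ≤ prob q a s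
  sum_eq_one : ∀ q a, ∑ s, prob q a s = 1
  feasible : ∀ (q : Fin (L.Q + 1)) (a : Fin (L.A + 1)) (s : Fin (L.S + 1)),
    ¬ L.Feasible q s → prob q a s = 0

/-- Transition matrix of the chain `(q[n], a[n])` under a policy: a rate `s` is drawn, the next
arrival number `a'` is drawn from `γ a ·`, and the next queue length is `q - s + a'`. -/
def Policy.trans {L : Link} (F : L.Policy) : Matrix L.State L.State ℝ :=
  Matrix.of fun x y => L.γ x.2 y.2 *
    ∑ s, F.prob x.1 x.2 s * (if (y.1 : ℕ) + (s : ℕ) = (x.1 : ℕ) + (y.2 : ℕ) then 1 else 0)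

/-- Expected power spent in a slot that starts in the given state. -/
def Policy.slotPower {L : Link} (F : L.Policy) (x : L.State) : ℝ :=
  ∑ s : Fin (L.S + 1), F.prob x.1 x.2 s * L.P s

/-- The long-run average power from the initial state `z` exists and equals `p`, i.e.
`(1 / N) E_z [∑_{n = 1}^N P (s[n])] → p`. -/
def Policy.HasPower {L : Link} (F : L.Policy) (z : L.State) (p : ℝ) : Prop :=
  Tendsto (fun N : ℕ => (1 / (N : ℝ)) *
    ∑ n ∈ Finset.Icc 1 N, ((F.trans ^ n) *ᵥ F.slotPower) z) atTop (𝓝 p)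

/-- The long-run average delay from the initial state `z` exists and equals `d`, i.e.
`(1 / N) E_z [(1 / α) ∑_{n = 1}^N q[n]] → d`. -/
def Policy.HasDelay {L : Link} (F : L.Policy) (z : L.State) (d : ℝ) : Prop :=
  Tendsto (fun N : ℕ => (1 / (N : ℝ)) * ((1 / L.α) *
    ∑ n ∈ Finset.Icc 1 N, ((F.trans ^ n) *ᵥ fun x : L.State => ((x.1 : ℕ) : ℝ)) z))
    atTop (𝓝 d)

/-- State-action frequencies, `x q a s` being the long-run fraction of slots with queue length
`q`, arrival number `a` and rate `s`: probability vectors carried by feasible rates that satisfy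
the balance equations. -/
structure IsFrequency (L : Link) (x : Fin (L.Q + 1) → Fin (L.A + 1) → Fin (L.S + 1) → ℝ) :
    Prop where
  nonneg : ∀ q a s, 0 ≤ x q a s
  sum_eq_one : ∑ q, ∑ a, ∑ s, x q a s = 1
  feasible : ∀ (q : Fin (L.Q + 1)) (a : Fin (L.A + 1)) (s : Fin (L.S + 1)),
    ¬ L.Feasible q s → x q a s = 0
  balance : ∀ (q' : Fin (L.Q + 1)) (a' : Fin (L.A + 1)),
    ∑ q, ∑ a, ∑ s, L.γ a a' * x q a s *
      (if (q' : ℕ) + (s : ℕ) = (q : ℕ) + (a' : ℕ) then 1 else 0) = ∑ s, x q' a' s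

/-- Average power of state-action frequencies. -/
def avgPower (L : Link) (x : Fin (L.Q + 1) → Fin (L.A + 1) → Fin (L.S + 1) → ℝ) : ℝ :=
  ∑ q, ∑ a, ∑ s : Fin (L.S + 1), L.P s * x q a s

/-- Average delay of state-action frequencies (Little's law). -/
def avgDelay (L : Link) (x : Fin (L.Q + 1) → Fin (L.A + 1) → Fin (L.S + 1) → ℝ) : ℝ :=
  (1 / L.α) * ∑ q : Fin (L.Q + 1), ∑ a, ∑ s, ((q : ℕ) : ℝ) * x q a s

/-- The set of all obtainable (power, delay) pairs. -/
def obtainable (L : Link) : Set (ℝ × ℝ) :=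
  {r | ∃ x, L.IsFrequency x ∧ r = (L.avgPower x, L.avgDelay x)}

/-- The optimal delay-power tradeoff curve. -/
def tradeoffCurve (L : Link) : Set (ℝ × ℝ) :=
  {p | p ∈ L.obtainable ∧ ∀ r ∈ L.obtainable, p.1 ≤ r.1 ∨ p.2 ≤ r.2}

/-- `p` is obtainable and has the least delay among all obtainable pairs whose power is
at most `p.1`. -/
def IsDelayOptimal (L : Link) (p : ℝ × ℝ) : Prop :=
  p ∈ L.obtainable ∧ ∀ r ∈ L.obtainable, r.1 ≤ p.1 → p.2 ≤ r.2

/-- `π` is a steady-state distribution of the chain under `F`. -/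
def Policy.IsStationary {L : Link} (F : L.Policy) (π : L.State → ℝ) : Prop :=
  π ∈ stdSimplex ℝ L.State ∧ π ᵥ* F.trans = π

/-- The state-action frequencies of a policy in the steady state `π`. -/
def Policy.freq {L : Link} (F : L.Policy) (π : L.State → ℝ) :
    Fin (L.Q + 1) → Fin (L.A + 1) → Fin (L.S + 1) → ℝ :=
  fun q a s => π (q, a) * F.prob q a s

/-- `F` is described by the thresholds `th s a`: it uses the rate `s` when
`th (s - 1) a < q ≤ th s a`, except that in the one state `(th sStar aStar, aStar)` it randomizes
between the rates `sStar` and `sStar + 1`. -/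
structure Policy.IsThreshold {L : Link} (F : L.Policy) (th : ℤ → Fin (L.A + 1) → ℤ)
    (sStar : Fin L.S) (aStar : Fin (L.A + 1)) : Prop where
  th_neg_one : ∀ a, th (-1) a = -1
  th_zero : ∀ a, 0 ≤ th 0 a
  th_mono : ∀ a, ∀ s : ℕ, s < L.S → th s a ≤ th (s + 1) a
  th_last : ∀ a, th L.S a ≤ L.Q
  eq_one : ∀ (q : Fin (L.Q + 1)) (a : Fin (L.A + 1)) (s : Fin (L.S + 1)),
    (a ≠ aStar ∨ s ≠ sStar.castSucc) →
    th (((s : ℕ) : ℤ) - 1) a < ((q : ℕ) : ℤ) → ((q : ℕ) : ℤ) ≤ th ((s : ℕ) : ℤ) a →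
    F.prob q a s = 1
  eq_one_star : ∀ q : Fin (L.Q + 1),
    th (((sStar : ℕ) : ℤ) - 1) aStar < ((q : ℕ) : ℤ) →
    ((q : ℕ) : ℤ) < th ((sStar : ℕ) : ℤ) aStar →
    F.prob q aStar sStar.castSucc = 1
  randomized : ∀ q : Fin (L.Q + 1), ((q : ℕ) : ℤ) = th ((sStar : ℕ) : ℤ) aStar →
    F.prob q aStar sStar.castSucc + F.prob q aStar sStar.succ = 1
  eq_zero : ∀ (q : Fin (L.Q + 1)) (a : Fin (L.A + 1)) (s : Fin (L.S + 1)),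
    ¬ (th (((s : ℕ) : ℤ) - 1) a < ((q : ℕ) : ℤ) ∧ ((q : ℕ) : ℤ) ≤ th ((s : ℕ) : ℤ) a) →
    ¬ (a = aStar ∧ ((q : ℕ) : ℤ) = th ((sStar : ℕ) : ℤ) aStar ∧
      (s = sStar.castSucc ∨ s = sStar.succ)) →
    F.prob q a s = 0

end Link

end

/-! The set `obtainable` is convex, so a point of the tradeoff curve minimizes a nonnegative
combination of power and delay (`exists_weights`). It even minimizes power plus `lam` times delay,
with `lam > 0` if it is delay-optimal (`exists_minimizes`). The degenerate weights are handled by a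
pigeonhole over the finitely many deterministic policies, and by the uniqueness of the power at the
least delay.

For fixed `lam` this is an average-cost decision problem. Letting the discount tend to one yields
relative values that are convex in the queue length (`exists_averageCost`). Exchange arguments with
this convexity and that of `P` show that the optimal rates in each state form an interval whose end
points `lo` and `hi` are `Regular`: one more packet in the queue raises the rate by 0 or 1
(`exists_optRate_interval`). Frequencies have least cost exactly when they use optimal rates only.

Let a minimizer have mean queue length `m`. Some stationary law of `lo` has mean at least `m`, and
some law of `hi` has mean at most `m`. Regular rules lead from `lo` to `hi` by raising the rate by
one in one state at a time. Where the mean crosses `m`, a mixture of two neighbouring rules has a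
stationary law with mean exactly `m` (`exists_threshold_mixPolicy`). This mixture is a threshold
policy randomizing in one state, and equal cost forces equal power.

Stationary laws of such a mixture may fail to be unique, but they all have the same power
(`mixPolicy_power_unique`): the total power from two initial queue lengths differs by a bounded
amount. For `lam > 0` equal cost then gives equal delay, so time averages converge from every state.
Conversely, limits of averages under any policy are obtainable (`Policy.mem_obtainable`). -/

noncomputable section

/-! ### Finite Markov chains: time averages and stationary laws -/

namespace Markov

variable {X : Type*} [Fintype X]

lemma tendsto_dotProduct {u : ℕ → X → ℝ} {π : X → ℝ} (h : Tendsto u atTop (𝓝 π)) (f : X → ℝ) :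
    Tendsto (fun k => u k ⬝ᵥ f) atTop (𝓝 (π ⬝ᵥ f)) := by
  have hc : Continuous fun v : X → ℝ => v ⬝ᵥ f := by fun_prop
  exact (hc.tendsto π).comp h

variable [DecidableEq X]

/-- The average law of the first `N` steps of the chain with initial law `μ`. -/
def cesaroLaw (T : Matrix X X ℝ) (μ : X → ℝ) (N : ℕ) : X → ℝ :=
  (1 / (N : ℝ)) • ∑ n ∈ Finset.Icc 1 N, μ ᵥ* T ^ n

lemma vecMul_mem_stdSimplex {T : Matrix X X ℝ} (hT : T ∈ Matrix.rowStochastic ℝ X)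
    {μ : X → ℝ} (hμ : μ ∈ stdSimplex ℝ X) : μ ᵥ* T ∈ stdSimplex ℝ X := by
  refine ⟨fun x => Matrix.nonneg_vecMul_of_mem_rowStochastic hT hμ.1 x, ?_⟩
  have h := Matrix.vecMul_dotProduct_one_eq_one_rowStochastic hT (x := μ)
    (by simpa [dotProduct] using hμ.2)
  simpa [dotProduct] using h

lemma cesaroLaw_mem_stdSimplex {T : Matrix X X ℝ} (hT : T ∈ Matrix.rowStochastic ℝ X)
    {μ : X → ℝ} (hμ : μ ∈ stdSimplex ℝ X) {N : ℕ} (hN : 0 < N) :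
    cesaroLaw T μ N ∈ stdSimplex ℝ X := by
  have h := fun n => vecMul_mem_stdSimplex (pow_mem hT n) hμ
  have hN' : (N : ℝ) ≠ 0 := by positivity
  refine ⟨fun x => ?_, ?_⟩
  · simp only [cesaroLaw, Pi.smul_apply, Finset.sum_apply, smul_eq_mul]
    exact mul_nonneg (by positivity) (Finset.sum_nonneg fun n _ => (h n).1 x)
  · simp only [cesaroLaw, Pi.smul_apply, Finset.sum_apply, smul_eq_mul]
    rw [← Finset.mul_sum, Finset.sum_comm, Finset.sum_congr rfl fun n _ => (h n).2]
    simp [hN']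

lemma cesaroLaw_dotProduct (T : Matrix X X ℝ) (μ f : X → ℝ) (N : ℕ) :
    cesaroLaw T μ N ⬝ᵥ f = (1 / (N : ℝ)) * ∑ n ∈ Finset.Icc 1 N, μ ⬝ᵥ (T ^ n *ᵥ f) := by
  simp only [cesaroLaw, smul_dotProduct, sum_dotProduct, smul_eq_mul, Matrix.dotProduct_mulVec]

lemma cesaroLaw_single_dotProduct (T : Matrix X X ℝ) (z : X) (f : X → ℝ) (N : ℕ) :
    cesaroLaw T (Pi.single z 1) N ⬝ᵥ f =
      (1 / (N : ℝ)) * ∑ n ∈ Finset.Icc 1 N, (T ^ n *ᵥ f) z := by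
  simp [cesaroLaw_dotProduct]

lemma cesaroLaw_vecMul_sub (T : Matrix X X ℝ) (μ : X → ℝ) (N : ℕ) :
    cesaroLaw T μ N ᵥ* T - cesaroLaw T μ N =
      (1 / (N : ℝ)) • (μ ᵥ* T ^ (N + 1) - μ ᵥ* T) := by
  have h : ∀ N : ℕ, (∑ n ∈ Finset.Icc 1 N, μ ᵥ* T ^ n) ᵥ* T - ∑ n ∈ Finset.Icc 1 N, μ ᵥ* T ^ n
      = μ ᵥ* T ^ (N + 1) - μ ᵥ* T := by
    intro N
    induction N with
    | zero => simp
    | succ N ih =>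
      rw [Finset.sum_Icc_succ_top (by omega), Matrix.add_vecMul, Matrix.vecMul_vecMul, ← pow_succ]
      calc _ = ((∑ n ∈ Finset.Icc 1 N, μ ᵥ* T ^ n) ᵥ* T - ∑ n ∈ Finset.Icc 1 N, μ ᵥ* T ^ n)
            + (μ ᵥ* T ^ (N + 1 + 1) - μ ᵥ* T ^ (N + 1)) := by abel
        _ = _ := by rw [ih]; abel
  rw [← h, cesaroLaw, Matrix.smul_vecMul, smul_sub]

/-- The simplex is compact, and applying `T` changes an average law by a telescoped remainder of
order `1 / N`, so cluster points are stationary. The arbitrary sequence `ns` serves the subsequence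
criterion for convergence. -/
lemma exists_subseq_cesaroLaw_tendsto {T : Matrix X X ℝ} (hT : T ∈ Matrix.rowStochastic ℝ X)
    {μ : X → ℝ} (hμ : μ ∈ stdSimplex ℝ X) {ns : ℕ → ℕ} (hns : Tendsto ns atTop atTop) :
    ∃ ms : ℕ → ℕ, ∃ π ∈ stdSimplex ℝ X, StrictMono ms ∧ π ᵥ* T = π ∧
      Tendsto (fun k => cesaroLaw T μ (ns (ms k))) atTop (𝓝 π) := by
  obtain ⟨π, hπ, ms, hms, hlim⟩ := (isCompact_stdSimplex ℝ X).tendsto_subseq'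
    (x := fun k => cesaroLaw T μ (ns k))
    ((hns.eventually_gt_atTop 0).mono fun k hk => cesaroLaw_mem_stdSimplex hT hμ hk).frequently
  refine ⟨ms, π, hπ, hms, ?_, hlim⟩
  have hnm : Tendsto (fun k => ns (ms k)) atTop atTop := hns.comp hms.tendsto_atTop
  have h1 : Tendsto (fun k => cesaroLaw T μ (ns (ms k)) ᵥ* T - cesaroLaw T μ (ns (ms k)))
      atTop (𝓝 (π ᵥ* T - π)) := by
    refine Tendsto.sub ?_ hlim
    have hc : Continuous fun v : X → ℝ => v ᵥ* T := by fun_prop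
    exact (hc.tendsto π).comp hlim
  have h2 : Tendsto (fun k => cesaroLaw T μ (ns (ms k)) ᵥ* T - cesaroLaw T μ (ns (ms k)))
      atTop (𝓝 0) := by
    simp_rw [cesaroLaw_vecMul_sub]
    rw [tendsto_pi_nhds]
    intro x
    have h0 : Tendsto (fun k => 1 / ((ns (ms k) : ℕ) : ℝ)) atTop (𝓝 0) :=
      tendsto_one_div_atTop_nhds_zero_nat.comp hnm
    refine squeeze_zero_norm (fun k => ?_) h0
    have ha := vecMul_mem_stdSimplex (pow_mem hT (ns (ms k) + 1)) hμ
    have hb := vecMul_mem_stdSimplex hT hμ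
    have ha1 : (μ ᵥ* T ^ (ns (ms k) + 1)) x ≤ 1 := by
      rw [← ha.2]; exact Finset.single_le_sum (fun i _ => ha.1 i) (Finset.mem_univ x)
    have hb1 : (μ ᵥ* T) x ≤ 1 := by
      rw [← hb.2]; exact Finset.single_le_sum (fun i _ => hb.1 i) (Finset.mem_univ x)
    have ha0 := ha.1 x
    have hb0 := hb.1 x
    have hN : (0 : ℝ) ≤ 1 / ((ns (ms k) : ℕ) : ℝ) := by positivity
    simp only [Pi.smul_apply, Pi.sub_apply, smul_eq_mul, norm_mul, Real.norm_of_nonneg hN]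
    refine mul_le_of_le_one_right hN ?_
    rw [Real.norm_eq_abs, abs_le]
    constructor <;> linarith
  exact sub_eq_zero.1 (tendsto_nhds_unique h1 h2)

/-- A stochastic matrix has a stationary law. If `f` has mean at least `m` at every time, the
stationary law can be chosen to give `f` mean at least `m`. -/
lemma exists_stationary_ge {T : Matrix X X ℝ} (hT : T ∈ Matrix.rowStochastic ℝ X)
    {μ : X → ℝ} (hμ : μ ∈ stdSimplex ℝ X) {f : X → ℝ} {m : ℝ}
    (hf : ∀ n, m ≤ μ ⬝ᵥ (T ^ n *ᵥ f)) :
    ∃ π ∈ stdSimplex ℝ X, π ᵥ* T = π ∧ m ≤ π ⬝ᵥ f := by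
  obtain ⟨ms, π, hπ, hms, hst, hlim⟩ := exists_subseq_cesaroLaw_tendsto hT hμ tendsto_id
  refine ⟨π, hπ, hst, ge_of_tendsto (tendsto_dotProduct hlim f) ?_⟩
  filter_upwards [hms.tendsto_atTop.eventually_gt_atTop 0] with k hk
  rw [id, cesaroLaw_dotProduct, one_div, inv_mul_eq_div, le_div_iff₀ (by positivity)]
  calc m * (ms k : ℝ) = ∑ n ∈ Finset.Icc 1 (ms k), m := by simp [mul_comm]
    _ ≤ _ := Finset.sum_le_sum fun n _ => hf n

/-- If all stationary laws give `f` the same mean, then the time averages of `f` converge to it. -/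
lemma tendsto_average_of_forall_stationary {T : Matrix X X ℝ}
    (hT : T ∈ Matrix.rowStochastic ℝ X) {f : X → ℝ} {v : ℝ}
    (hf : ∀ π ∈ stdSimplex ℝ X, π ᵥ* T = π → π ⬝ᵥ f = v) (z : X) :
    Tendsto (fun N : ℕ => (1 / (N : ℝ)) * ∑ n ∈ Finset.Icc 1 N, (T ^ n *ᵥ f) z)
      atTop (𝓝 v) := by
  simp_rw [← cesaroLaw_single_dotProduct]
  refine tendsto_of_subseq_tendsto fun ns hns => ?_
  obtain ⟨ms, π, hπ, -, hst, hlim⟩ :=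
    exists_subseq_cesaroLaw_tendsto hT (single_mem_stdSimplex ℝ z) hns
  exact ⟨ms, hf π hπ hst ▸ tendsto_dotProduct hlim f⟩

/-- Limits of time averages are means under a stationary law. -/
lemma exists_stationary_of_tendsto_average {T : Matrix X X ℝ}
    (hT : T ∈ Matrix.rowStochastic ℝ X) {z : X} {f g : X → ℝ} {v w : ℝ}
    (hf : Tendsto (fun N : ℕ => (1 / (N : ℝ)) * ∑ n ∈ Finset.Icc 1 N, (T ^ n *ᵥ f) z)
      atTop (𝓝 v))
    (hg : Tendsto (fun N : ℕ => (1 / (N : ℝ)) * ∑ n ∈ Finset.Icc 1 N, (T ^ n *ᵥ g) z)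
      atTop (𝓝 w)) :
    ∃ π ∈ stdSimplex ℝ X, π ᵥ* T = π ∧ π ⬝ᵥ f = v ∧ π ⬝ᵥ g = w := by
  obtain ⟨ms, π, hπ, hms, hst, hlim⟩ :=
    exists_subseq_cesaroLaw_tendsto hT (single_mem_stdSimplex ℝ z) tendsto_id
  simp_rw [← cesaroLaw_single_dotProduct] at hf hg
  exact ⟨π, hπ, hst,
    tendsto_nhds_unique (tendsto_dotProduct hlim f) (hf.comp hms.tendsto_atTop),
    tendsto_nhds_unique (tendsto_dotProduct hlim g) (hg.comp hms.tendsto_atTop)⟩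

lemma dotProduct_pow_mulVec {T : Matrix X X ℝ} {π : X → ℝ} (h : π ᵥ* T = π) (f : X → ℝ) (n : ℕ) :
    π ⬝ᵥ (T ^ n *ᵥ f) = π ⬝ᵥ f := by
  induction n with
  | zero => simp
  | succ n ih => rw [pow_succ', ← Matrix.mulVec_mulVec, Matrix.dotProduct_mulVec, h, ih]

lemma vecMul_pow {T : Matrix X X ℝ} {π : X → ℝ} (h : π ᵥ* T = π) (n : ℕ) :
    π ᵥ* T ^ n = π := by
  induction n with
  | zero => simp
  | succ n ih => rw [pow_succ, ← Matrix.vecMul_vecMul, ih, h]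

/-- A nonnegative invariant vector of an irreducible matrix that vanishes somewhere is zero. -/
lemma eq_zero_of_stationary {T : Matrix X X ℝ} (hT : T.IsIrreducible) {ν : X → ℝ}
    (hν : 0 ≤ ν) (hst : ν ᵥ* T = ν) {j : X} (hj : ν j = 0) : ν = 0 := by
  funext i
  obtain ⟨k, -, hk⟩ := (Matrix.isIrreducible_iff_exists_pow_pos hT.1).1 hT i j
  have h : ∑ i, ν i * (T ^ k) i j = 0 := by
    have := congrFun (vecMul_pow hst k) j
    rwa [hj] at this
  have hTk : ∀ i, 0 ≤ (T ^ k) i j := fun i => Matrix.pow_apply_nonneg hT.1 k i j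
  rw [Finset.sum_eq_zero_iff_of_nonneg fun i _ => mul_nonneg (hν i) (hTk i)] at h
  exact (mul_eq_zero.1 (h i (Finset.mem_univ i))).resolve_right hk.ne'

lemma stationary_pos {T : Matrix X X ℝ} (hT : T.IsIrreducible) {π : X → ℝ}
    (hπ : π ∈ stdSimplex ℝ X) (hst : π ᵥ* T = π) (i : X) : 0 < π i := by
  refine lt_of_le_of_ne (hπ.1 i) fun h => ?_
  have h0 := eq_zero_of_stationary hT hπ.1 hst h.symm
  have := hπ.2
  simp [h0] at this

/-- The stationary law of an irreducible matrix is unique. -/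
lemma stationary_unique {T : Matrix X X ℝ} (hT : T.IsIrreducible) {π ν : X → ℝ}
    (hπ : π ∈ stdSimplex ℝ X) (hπT : π ᵥ* T = π) (hν : ν ∈ stdSimplex ℝ X)
    (hνT : ν ᵥ* T = ν) : ν = π := by
  have hpos := stationary_pos hT hπ hπT
  have hne : (Finset.univ : Finset X).Nonempty := by
    by_contra h
    have h2 := hπ.2
    rw [Finset.not_nonempty_iff_eq_empty.1 h] at h2
    simp at h2
  -- Subtract from `ν` the largest multiple of `π` that keeps it nonnegative; the difference is
  -- invariant and vanishes at `j`.
  obtain ⟨j, -, hj⟩ := Finset.exists_min_image Finset.univ (fun i => ν i / π i) hne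
  have h0 : ν - (ν j / π j) • π = 0 := by
    refine eq_zero_of_stationary hT (fun i => ?_) ?_ (j := j) ?_
    · have := hj i (Finset.mem_univ i)
      rw [le_div_iff₀ (hpos i)] at this
      simpa using this
    · rw [Matrix.sub_vecMul, Matrix.smul_vecMul, hπT, hνT]
    · have := (hpos j).ne'
      simp; field_simp; simp
  have h1 : ν = (ν j / π j) • π := sub_eq_zero.1 h0
  have h2 : (1 : ℝ) = ν j / π j := by
    have h3 := hν.2
    rw [h1] at h3
    simp only [Pi.smul_apply, smul_eq_mul, ← Finset.mul_sum, hπ.2, mul_one] at h3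
    exact h3.symm
  rw [h1, ← h2, one_smul]

end Markov

/-! ### Policies, state-action frequencies and the balance equations -/

namespace Link

/-- The queue length `n`, truncated at the buffer size. -/
def idx (L : Link) (n : ℕ) : Fin (L.Q + 1) := ⟨min n L.Q, by omega⟩

lemma idx_val {L : Link} {n : ℕ} (h : n ≤ L.Q) : (L.idx n : ℕ) = n := min_eq_left h

/-- Expected value of `f` in the next state, if there are `a` arrivals in this slot and `u` packets
are left after the transmission. -/
def cont (L : Link) (f : L.State → ℝ) (a : Fin (L.A + 1)) (u : ℕ) : ℝ :=
  ∑ a', L.γ a a' * f (L.idx (u + a'), a')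

lemma Feasible.sub_add_le {L : Link} {q s : ℕ} (h : L.Feasible q s) (a : Fin (L.A + 1)) :
    q - s + a ≤ L.Q := by
  obtain ⟨h1, h2, h3⟩ := h
  omega

lemma γ_nonneg (L : Link) (a a' : Fin (L.A + 1)) : 0 ≤ L.γ a a' :=
  Matrix.nonneg_of_mem_rowStochastic L.γ_stochastic

lemma sum_γ (L : Link) (a : Fin (L.A + 1)) : ∑ a', L.γ a a' = 1 :=
  Matrix.sum_row_of_mem_rowStochastic L.γ_stochastic a

lemma cont_mono {L : Link} {f g : L.State → ℝ} (h : ∀ z, f z ≤ g z) (a : Fin (L.A + 1)) (u : ℕ) :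
    L.cont f a u ≤ L.cont g a u :=
  Finset.sum_le_sum fun a' _ => mul_le_mul_of_nonneg_left (h _) (L.γ_nonneg a a')

lemma cont_const (L : Link) (c : ℝ) (a : Fin (L.A + 1)) (u : ℕ) :
    L.cont (fun _ => c) a u = c := by
  simp [cont, ← Finset.sum_mul, L.sum_γ]

lemma cont_add (L : Link) (f g : L.State → ℝ) (a : Fin (L.A + 1)) (u : ℕ) :
    L.cont (fun z => f z + g z) a u = L.cont f a u + L.cont g a u := by
  simp [cont, mul_add, Finset.sum_add_distrib]

lemma cont_sub (L : Link) (f g : L.State → ℝ) (a : Fin (L.A + 1)) (u : ℕ) :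
    L.cont (fun z => f z - g z) a u = L.cont f a u - L.cont g a u := by
  simp [cont, mul_sub, Finset.sum_sub_distrib]

lemma cont_eq_sum {L : Link} (f : L.State → ℝ) {q s : ℕ} (a : Fin (L.A + 1))
    (h : L.Feasible q s) :
    L.cont f a (q - s) = ∑ q' : Fin (L.Q + 1), ∑ a' : Fin (L.A + 1),
      L.γ a a' * (if (q' : ℕ) + s = q + (a' : ℕ) then 1 else 0) * f (q', a') := by
  rw [Finset.sum_comm, cont]
  refine Finset.sum_congr rfl fun a' _ => ?_
  rw [Finset.sum_eq_single (L.idx (q - s + a'))]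
  · have h1 := idx_val (h.sub_add_le a')
    have h2 := h.2.1
    rw [if_pos (by omega), mul_one]
  · intro q' _ hq'
    have h2 := h.2.1
    rw [if_neg, mul_zero, zero_mul]
    intro h3
    refine hq' (Fin.ext ?_)
    rw [idx_val (h.sub_add_le a')]
    omega
  · simp

/-- Infeasible rates have probability zero, so neither the truncation in `idx` nor the natural
subtraction is ever felt. -/
lemma Policy.trans_mulVec {L : Link} (F : L.Policy) (f : L.State → ℝ) (z : L.State) :
    (F.trans *ᵥ f) z = ∑ s : Fin (L.S + 1), F.prob z.1 z.2 s * L.cont f z.2 (z.1 - s) := by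
  have h : ∀ s : Fin (L.S + 1), F.prob z.1 z.2 s * L.cont f z.2 (z.1 - s) =
      ∑ q' : Fin (L.Q + 1), ∑ a' : Fin (L.A + 1), L.γ z.2 a' * (F.prob z.1 z.2 s *
        (if (q' : ℕ) + s = z.1 + (a' : ℕ) then 1 else 0)) * f (q', a') := by
    intro s
    by_cases hs : L.Feasible z.1 s
    · rw [cont_eq_sum f _ hs, Finset.mul_sum]
      refine Finset.sum_congr rfl fun q' _ => ?_
      rw [Finset.mul_sum]
      refine Finset.sum_congr rfl fun a' _ => ?_
      ring
    · simp [F.feasible _ _ _ hs]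
  rw [Finset.sum_congr rfl fun s _ => h s, Finset.sum_comm]
  simp only [Matrix.mulVec, dotProduct, Policy.trans, Matrix.of_apply, Fintype.sum_prod_type]
  refine Finset.sum_congr rfl fun q' _ => ?_
  rw [Finset.sum_comm]
  refine Finset.sum_congr rfl fun a' _ => ?_
  rw [Finset.mul_sum, Finset.sum_mul]

lemma Policy.trans_mem_rowStochastic {L : Link} (F : L.Policy) :
    F.trans ∈ Matrix.rowStochastic ℝ L.State := by
  refine Matrix.mem_rowStochastic.2 ⟨fun z y => ?_, ?_⟩
  · refine mul_nonneg (L.γ_nonneg _ _) (Finset.sum_nonneg fun s _ => ?_)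
    refine mul_nonneg (F.nonneg _ _ _) ?_
    split_ifs <;> norm_num
  · funext z
    rw [Policy.trans_mulVec]
    have : ∀ u, L.cont 1 z.2 u = 1 := L.cont_const 1 z.2
    simp [this, F.sum_eq_one]

lemma Policy.exists_isStationary {L : Link} (F : L.Policy) : ∃ π, F.IsStationary π := by
  obtain ⟨π, hπ, h, -⟩ := Markov.exists_stationary_ge F.trans_mem_rowStochastic
    (single_mem_stdSimplex ℝ ((0, 0) : L.State)) (f := fun _ => 0) (m := 0) (by
      intro n; simp [Matrix.mulVec, dotProduct])
  exact ⟨π, hπ, h⟩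

/-- The mean of `c z s` over states `z` and rates `s` with frequencies `x`. -/
def mean (L : Link) (x : Fin (L.Q + 1) → Fin (L.A + 1) → Fin (L.S + 1) → ℝ)
    (c : L.State → ℕ → ℝ) : ℝ :=
  ∑ q, ∑ a, ∑ s : Fin (L.S + 1), x q a s * c (q, a) s

section Mean

variable {L : Link} {x : Fin (L.Q + 1) → Fin (L.A + 1) → Fin (L.S + 1) → ℝ}
  {c d : L.State → ℕ → ℝ}

lemma mean_add : L.mean x (fun z s => c z s + d z s) = L.mean x c + L.mean x d := by
  simp [mean, mul_add, Finset.sum_add_distrib]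

lemma mean_sub : L.mean x (fun z s => c z s - d z s) = L.mean x c - L.mean x d := by
  simp [mean, mul_sub, Finset.sum_sub_distrib]

lemma mean_const_mul (r : ℝ) : L.mean x (fun z s => r * c z s) = r * L.mean x c := by
  simp [mean, Finset.mul_sum, mul_left_comm]

lemma mean_const (hx : L.IsFrequency x) (r : ℝ) : L.mean x (fun _ _ => r) = r := by
  simp only [mean, ← Finset.sum_mul, hx.sum_eq_one, one_mul]

lemma mean_mono (hx : L.IsFrequency x)
    (h : ∀ (z : L.State) (s : Fin (L.S + 1)), x z.1 z.2 s ≠ 0 → L.Feasible z.1 s → c z s ≤ d z s) :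
    L.mean x c ≤ L.mean x d := by
  refine Finset.sum_le_sum fun q _ => Finset.sum_le_sum fun a _ => Finset.sum_le_sum fun s _ => ?_
  by_cases h0 : x q a s = 0
  · simp [h0]
  · have hs : L.Feasible q s := by
      by_contra hs
      exact h0 (hx.feasible _ _ _ hs)
    exact mul_le_mul_of_nonneg_left (h (q, a) s h0 hs) (hx.nonneg _ _ _)

lemma mean_congr (hx : L.IsFrequency x)
    (h : ∀ (z : L.State) (s : Fin (L.S + 1)), x z.1 z.2 s ≠ 0 → L.Feasible z.1 s → c z s = d z s) :
    L.mean x c = L.mean x d :=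
  le_antisymm (mean_mono hx fun z s h0 hs => (h z s h0 hs).le)
    (mean_mono hx fun z s h0 hs => (h z s h0 hs).ge)

/-- Complementary slackness, used for the defect in the optimality equation and for the packets left
in the queue. -/
lemma eq_zero_of_mean_eq_zero (hx : L.IsFrequency x)
    (hc : ∀ (z : L.State) (s : Fin (L.S + 1)), L.Feasible z.1 s → 0 ≤ c z s)
    (h : L.mean x c = 0) (z : L.State) (s : Fin (L.S + 1)) (h0 : x z.1 z.2 s ≠ 0) :
    c z s = 0 := by
  have hn : ∀ q a (s : Fin (L.S + 1)), 0 ≤ x q a s * c (q, a) s := by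
    intro q a s
    by_cases hs : L.Feasible q s
    · exact mul_nonneg (hx.nonneg _ _ _) (hc (q, a) s hs)
    · simp [hx.feasible _ _ _ hs]
  rw [mean, Finset.sum_eq_zero_iff_of_nonneg fun q _ => Finset.sum_nonneg fun a _ =>
    Finset.sum_nonneg fun s _ => hn q a s] at h
  have h1 := h z.1 (Finset.mem_univ _)
  rw [Finset.sum_eq_zero_iff_of_nonneg fun a _ => Finset.sum_nonneg fun s _ => hn _ a s] at h1
  have h2 := h1 z.2 (Finset.mem_univ _)
  rw [Finset.sum_eq_zero_iff_of_nonneg fun s _ => hn _ _ s] at h2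
  exact (mul_eq_zero.1 (h2 s (Finset.mem_univ _))).resolve_left h0

/-- The balance equations, tested against a function. -/
lemma mean_cont (hx : L.IsFrequency x) (f : L.State → ℝ) :
    L.mean x (fun z s => L.cont f z.2 (z.1 - s)) = L.mean x (fun z _ => f z) := by
  have h1 : L.mean x (fun z s => L.cont f z.2 (z.1 - s)) =
      L.mean x (fun z s => ∑ q' : Fin (L.Q + 1), ∑ a' : Fin (L.A + 1),
        L.γ z.2 a' * (if (q' : ℕ) + s = z.1 + (a' : ℕ) then 1 else 0) * f (q', a')) :=
    mean_congr hx fun z s _ hs => cont_eq_sum f z.2 hs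
  have h2 : L.mean x (fun z _ => f z) = ∑ q' : Fin (L.Q + 1), ∑ a' : Fin (L.A + 1),
      (∑ q : Fin (L.Q + 1), ∑ a, ∑ s, L.γ a a' * x q a s *
        (if (q' : ℕ) + (s : ℕ) = (q : ℕ) + (a' : ℕ) then 1 else 0)) * f (q', a') := by
    simp only [hx.balance, mean, Finset.sum_mul]
  rw [h1, h2, mean]
  simp only [Finset.mul_sum, Finset.sum_mul]
  have hq : ∀ g : Fin (L.Q + 1) → Fin (L.A + 1) → Fin (L.S + 1) → Fin (L.Q + 1) →
      Fin (L.A + 1) → ℝ, ∑ q, ∑ a, ∑ s, ∑ q', ∑ a', g q a s q' a' =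
        ∑ q', ∑ a', ∑ q, ∑ a, ∑ s, g q a s q' a' := by
    intro g
    simp only [← Fintype.sum_prod_type']
    exact Fintype.sum_equiv ⟨fun p => ⟨p.2.2.2.1, p.2.2.2.2, p.1, p.2.1, p.2.2.1⟩,
      fun p => ⟨p.2.2.1, p.2.2.2.1, p.2.2.2.2, p.1, p.2.1⟩, fun _ => rfl, fun _ => rfl⟩ _ _
      fun _ => rfl
  rw [hq]
  refine Finset.sum_congr rfl fun q' _ => Finset.sum_congr rfl fun a' _ =>
    Finset.sum_congr rfl fun q _ => Finset.sum_congr rfl fun a _ =>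
    Finset.sum_congr rfl fun s _ => ?_
  ring

lemma avgPower_eq_mean : L.avgPower x = L.mean x (fun _ s => L.P s) := by
  simp only [avgPower, mean, mul_comm]

lemma avgDelay_eq_mean :
    L.avgDelay x = (1 / L.α) * L.mean x (fun z _ => ((z.1 : ℕ) : ℝ)) := by
  simp only [avgDelay, mean, mul_comm]

lemma mean_freq (F : L.Policy) (π : L.State → ℝ) (c : L.State → ℕ → ℝ) :
    L.mean (F.freq π) c =
      π ⬝ᵥ fun z => ∑ s : Fin (L.S + 1), F.prob z.1 z.2 s * c z s := by
  simp only [mean, Policy.freq, dotProduct, Fintype.sum_prod_type, Finset.mul_sum, mul_assoc]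

lemma mean_freq_state (F : L.Policy) (π f : L.State → ℝ) :
    L.mean (F.freq π) (fun z _ => f z) = π ⬝ᵥ f := by
  rw [mean_freq]
  simp only [← Finset.sum_mul, F.sum_eq_one, one_mul]

end Mean

lemma Policy.IsStationary.isFrequency {L : Link} {F : L.Policy} {π : L.State → ℝ}
    (h : F.IsStationary π) : L.IsFrequency (F.freq π) where
  nonneg q a s := mul_nonneg (h.1.1 _) (F.nonneg _ _ _)
  sum_eq_one := by
    simp only [Policy.freq, ← Finset.mul_sum, F.sum_eq_one, mul_one]
    rw [← h.1.2, Fintype.sum_prod_type]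
  feasible q a s hs := by simp [Policy.freq, F.feasible q a s hs]
  balance q' a' := by
    simp only [Policy.freq, ← Finset.mul_sum, F.sum_eq_one, mul_one]
    conv_rhs => rw [← h.2]
    simp only [Matrix.vecMul, dotProduct, Policy.trans, Matrix.of_apply, Fintype.sum_prod_type,
      Finset.mul_sum]
    refine Finset.sum_congr rfl fun q _ => Finset.sum_congr rfl fun a _ =>
      Finset.sum_congr rfl fun s _ => ?_
    ring

lemma IsFrequency.mem_obtainable {L : Link}
    {x : Fin (L.Q + 1) → Fin (L.A + 1) → Fin (L.S + 1) → ℝ} (hx : L.IsFrequency x) :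
    (L.avgPower x, L.avgDelay x) ∈ L.obtainable := ⟨x, hx, rfl⟩

lemma φ_pos (L : Link) (a : Fin (L.A + 1)) : 0 < L.φ a :=
  Markov.stationary_pos L.γ_irreducible L.φ_mem L.φ_stationary a

lemma α_pos (L : Link) : 0 < L.α := by
  refine Finset.sum_pos' (fun a _ => mul_nonneg (by positivity) (L.φ_pos a).le)
    ⟨Fin.last L.A, Finset.mem_univ _, mul_pos ?_ (L.φ_pos _)⟩
  simpa using L.A_pos

/-- Under state-action frequencies, the arrival number has its stationary law. -/
lemma IsFrequency.marginal {L : Link}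
    {x : Fin (L.Q + 1) → Fin (L.A + 1) → Fin (L.S + 1) → ℝ} (hx : L.IsFrequency x)
    (a : Fin (L.A + 1)) : ∑ q, ∑ s, x q a s = L.φ a := by
  have key : ∀ f : Fin (L.A + 1) → ℝ,
      L.mean x (fun z _ => f z.2) = ∑ a, (∑ q, ∑ s, x q a s) * f a := by
    intro f
    simp only [mean, Finset.sum_mul]
    rw [Finset.sum_comm]
  refine congrFun (Markov.stationary_unique L.γ_irreducible L.φ_mem L.φ_stationary
    (ν := fun a => ∑ q, ∑ s, x q a s) ⟨fun a => ?_, ?_⟩ ?_) a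
  · exact Finset.sum_nonneg fun q _ => Finset.sum_nonneg fun s _ => hx.nonneg _ _ _
  · have := key fun _ => 1
    simp only [mul_one] at this
    rw [← this, mean_const hx]
  · funext b
    -- The balance equations tested on an indicator of the arrival number say that the marginal is
    -- invariant under `γ`.
    have h1 := mean_cont hx fun z => if z.2 = b then 1 else 0
    have h2 : L.mean x (fun z s => L.cont (fun z => if z.2 = b then 1 else 0) z.2 (z.1 - s)) =
        L.mean x (fun z _ => L.γ z.2 b) := by simp [cont]
    rw [h2, key (fun a => L.γ a b), key fun a => if a = b then 1 else 0] at h1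
    simpa [Matrix.vecMul, dotProduct] using h1

lemma IsFrequency.mean_arrival {L : Link}
    {x : Fin (L.Q + 1) → Fin (L.A + 1) → Fin (L.S + 1) → ℝ} (hx : L.IsFrequency x)
    (f : Fin (L.A + 1) → ℝ) : L.mean x (fun z _ => f z.2) = ∑ a, L.φ a * f a := by
  simp only [mean, ← hx.marginal, Finset.sum_mul]
  rw [Finset.sum_comm]

end Link

/-! ### Discounted problem: the Bellman operator preserves convexity -/

/-- Moving two arguments of a discretely convex function towards each other does not increase
the sum of the values. -/
lemma add_le_add_of_discrete_convex {f : ℕ → ℝ} {N : ℕ}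
    (hf : ∀ n, n + 2 ≤ N → f (n + 1) - f n ≤ f (n + 2) - f (n + 1)) {i j : ℕ} (hij : i < j)
    (hj : j ≤ N) : f (i + 1) + f (j - 1) ≤ f i + f j := by
  obtain ⟨k, rfl⟩ : ∃ k, j = i + k + 1 := ⟨j - i - 1, by omega⟩
  have h : f (i + 1) - f i ≤ f (i + k + 1) - f (i + k) := by
    clear hij
    induction k with
    | zero => simp
    | succ k ih =>
      have h1 := ih (by omega)
      have h2 := hf (i + k) (by omega)
      have e1 : i + (k + 1) + 1 = i + k + 2 := by ring
      have e2 : i + (k + 1) = i + k + 1 := by ring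
      rw [e1, e2]
      linarith
  rw [Nat.add_sub_cancel]
  linarith

namespace Link

/-- The feasible rates at queue length `q`. -/
def rates (L : Link) (q : ℕ) : Finset ℕ :=
  (Finset.range (L.S + 1)).filter fun s => q + L.A ≤ s + L.Q ∧ s ≤ q

lemma mem_rates {L : Link} {q s : ℕ} : s ∈ L.rates q ↔ L.Feasible q s := by
  simp only [rates, Finset.mem_filter, Finset.mem_range, Feasible]
  omega

lemma feasible_min {L : Link} {q : ℕ} (hq : q ≤ L.Q) : L.Feasible q (min q L.S) := by
  have h1 := L.A_le_S
  have h2 := L.A_le_Q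
  refine ⟨?_, ?_, ?_⟩ <;> omega

lemma rates_nonempty (L : Link) (q : Fin (L.Q + 1)) : (L.rates q).Nonempty :=
  ⟨_, mem_rates.2 (feasible_min (by omega))⟩

/-- Cost of the rate `s` in the state `z`, with weight `μ` on the queue length, discount `β` and
cost-to-go `V`. -/
def qval (L : Link) (μ β : ℝ) (V : L.State → ℝ) (z : L.State) (s : ℕ) : ℝ :=
  L.P s + μ * ((z.1 : ℕ) : ℝ) + β * L.cont V z.2 (z.1 - s)

/-- The Bellman operator. -/
def bellman (L : Link) (μ β : ℝ) (V : L.State → ℝ) (z : L.State) : ℝ :=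
  (L.rates z.1).inf' (L.rates_nonempty z.1) (L.qval μ β V z)

/-- Convexity in the queue length. -/
def QueueConvex (L : Link) (V : L.State → ℝ) : Prop :=
  ∀ (a : Fin (L.A + 1)) (q : ℕ), q + 2 ≤ L.Q →
    V (L.idx (q + 1), a) - V (L.idx q, a) ≤ V (L.idx (q + 2), a) - V (L.idx (q + 1), a)

section Bellman

variable {L : Link} {μ β : ℝ} {V W : L.State → ℝ}

lemma bellman_le (z : L.State) {s : ℕ} (hs : L.Feasible z.1 s) :
    L.bellman μ β V z ≤ L.qval μ β V z s :=
  Finset.inf'_le _ (mem_rates.2 hs)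

lemma exists_bellman_eq (μ β : ℝ) (V : L.State → ℝ) (z : L.State) :
    ∃ s, L.Feasible z.1 s ∧ L.bellman μ β V z = L.qval μ β V z s := by
  obtain ⟨s, hs, h⟩ := Finset.exists_mem_eq_inf' (L.rates_nonempty z.1) (L.qval μ β V z)
  exact ⟨s, mem_rates.1 hs, h⟩

lemma P_nonneg {s : ℕ} (hs : s ≤ L.S) : 0 ≤ L.P s := by
  rw [← L.P_zero]
  exact L.P_mono (Set.mem_Iic.2 (Nat.zero_le _)) (Set.mem_Iic.2 hs) (Nat.zero_le _)

lemma P_le {s : ℕ} (hs : s ≤ L.S) : L.P s ≤ L.P L.S :=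
  L.P_mono (Set.mem_Iic.2 hs) (Set.mem_Iic.2 le_rfl) hs

lemma QueueConvex.cont (hV : L.QueueConvex V) (a : Fin (L.A + 1)) {u : ℕ}
    (hu : u + 2 ≤ L.Q - L.A) :
    L.cont V a (u + 1) - L.cont V a u ≤ L.cont V a (u + 2) - L.cont V a (u + 1) := by
  simp only [Link.cont, ← Finset.sum_sub_distrib, ← mul_sub]
  refine Finset.sum_le_sum fun a' _ => mul_le_mul_of_nonneg_left ?_ (L.γ_nonneg a a')
  have := hV a' (u + a') (by omega)
  rwa [show u + 1 + (a' : ℕ) = u + a' + 1 by ring, show u + 2 + (a' : ℕ) = u + a' + 2 by ring]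

lemma P_exchange {s t : ℕ} (hst : s < t) (ht : t ≤ L.S) :
    L.P (s + 1) + L.P (t - 1) ≤ L.P s + L.P t :=
  add_le_add_of_discrete_convex L.P_convex hst ht

lemma QueueConvex.cont_exchange (hV : L.QueueConvex V) (a : Fin (L.A + 1)) {u v : ℕ}
    (huv : u < v) (hv : v ≤ L.Q - L.A) :
    L.cont V a (u + 1) + L.cont V a (v - 1) ≤ L.cont V a u + L.cont V a v :=
  add_le_add_of_discrete_convex (fun _ h => hV.cont a h) huv hv

/-- From optimal rates `s₁` at `q` and `s₂` at `q + 2`, two rates for `q + 1` are built with no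
larger total cost. If `s₂ ≤ s₁`, keeping the rates moves the remainders towards each other, and `V`
pays. If `s₂ = s₁ + 1`, keeping them merely swaps the remainders. If `s₂` is larger, the rates move
towards each other with the remainders unchanged, and `P` pays. -/
lemma QueueConvex.bellman (hV : L.QueueConvex V) (hβ : 0 ≤ β) :
    L.QueueConvex (L.bellman μ β V) := by
  intro a q hq
  obtain ⟨s₁, ⟨h11, h12, h13⟩, e₁⟩ := exists_bellman_eq μ β V (L.idx q, a)
  obtain ⟨s₂, ⟨h21, h22, h23⟩, e₂⟩ := exists_bellman_eq μ β V (L.idx (q + 2), a)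
  have i0 : (L.idx q : ℕ) = q := idx_val (by omega)
  have i1 : (L.idx (q + 1) : ℕ) = q + 1 := idx_val (by omega)
  have i2 : (L.idx (q + 2) : ℕ) = q + 2 := idx_val (by omega)
  simp only [i0, i2] at h11 h12 h21 h22
  have hA := L.A_le_Q
  have key : ∀ {s t : ℕ}, L.Feasible (q + 1) s → L.Feasible (q + 1) t →
      L.P s + L.P t + β * (L.cont V a (q + 1 - s) + L.cont V a (q + 1 - t)) ≤
        L.P s₁ + L.P s₂ + β * (L.cont V a (q - s₁) + L.cont V a (q + 2 - s₂)) →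
      L.bellman μ β V (L.idx (q + 1), a) - L.bellman μ β V (L.idx q, a) ≤
        L.bellman μ β V (L.idx (q + 2), a) - L.bellman μ β V (L.idx (q + 1), a) := by
    intro s t hs ht h
    have b1 := bellman_le (μ := μ) (β := β) (V := V) (L.idx (q + 1), a) (s := s) (by rwa [i1])
    have b2 := bellman_le (μ := μ) (β := β) (V := V) (L.idx (q + 1), a) (s := t) (by rwa [i1])
    rw [e₁, e₂]
    simp only [qval, i0, i1, i2] at b1 b2 ⊢
    push_cast at b1 b2 ⊢
    linarith
  rcases lt_trichotomy s₂ (s₁ + 1) with hlt | heq | hgt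
  · have hx := hV.cont_exchange a (u := q - s₁) (v := q + 2 - s₂) (by omega) (by omega)
    refine key (s := s₁) (t := s₂) ⟨by omega, by omega, h13⟩ ⟨by omega, by omega, h23⟩ ?_
    rw [show q + 1 - s₁ = q - s₁ + 1 by omega, show q + 1 - s₂ = q + 2 - s₂ - 1 by omega]
    have := mul_le_mul_of_nonneg_left hx hβ
    linarith
  · refine key (s := s₁) (t := s₂) ⟨by omega, by omega, h13⟩ ⟨by omega, by omega, h23⟩ ?_
    rw [show q + 1 - s₁ = q + 2 - s₂ by omega, show q + 1 - s₂ = q - s₁ by omega]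
    linarith
  · have hx := P_exchange (L := L) (s := s₁) (t := s₂) (by omega) h23
    refine key (s := s₁ + 1) (t := s₂ - 1) ⟨by omega, by omega, by omega⟩
      ⟨by omega, by omega, by omega⟩ ?_
    rw [show q + 1 - (s₁ + 1) = q - s₁ by omega,
      show q + 1 - (s₂ - 1) = q + 2 - s₂ by omega]
    linarith

lemma bellman_le_add_dist (hβ : 0 ≤ β) (z : L.State) :
    L.bellman μ β V z ≤ L.bellman μ β W z + β * dist V W := by
  obtain ⟨s, hs, e⟩ := exists_bellman_eq μ β W z
  refine (bellman_le z hs).trans ?_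
  rw [e]
  have h : L.cont V z.2 (z.1 - s) ≤ L.cont W z.2 (z.1 - s) + dist V W := by
    rw [← L.cont_const (dist V W) z.2 (z.1 - s), ← cont_add]
    refine cont_mono (fun y => ?_) _ _
    have := dist_le_pi_dist V W y
    rw [Real.dist_eq] at this
    linarith [le_abs_self (V y - W y)]
  have := mul_le_mul_of_nonneg_left h hβ
  simp only [qval]
  linarith

lemma contracting_bellman (μ : ℝ) {β : NNReal} (hβ : β < 1) :
    ContractingWith β (L.bellman μ β) := by
  refine ⟨hβ, LipschitzWith.of_dist_le_mul fun V W => ?_⟩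
  refine (dist_pi_le_iff (by positivity)).2 fun z => ?_
  have h1 := bellman_le_add_dist (V := V) (W := W) (μ := μ) β.2 z
  have h2 := bellman_le_add_dist (V := W) (W := V) (μ := μ) β.2 z
  rw [dist_comm W V] at h2
  rw [Real.dist_eq, abs_le]
  simp only [NNReal.val_eq_coe] at h1 h2
  constructor <;> linarith

lemma isClosed_queueConvex (L : Link) : IsClosed {V : L.State → ℝ | L.QueueConvex V} := by
  simp only [QueueConvex, Set.ofPred_forall]
  refine isClosed_iInter fun a => isClosed_iInter fun q => isClosed_iInter fun _ => ?_
  exact isClosed_le (by fun_prop) (by fun_prop)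

/-- The discounted optimality equation has a convex solution. -/
lemma exists_discounted (L : Link) (μ : ℝ) {β : NNReal} (hβ : β < 1) :
    ∃ V, L.QueueConvex V ∧ L.bellman μ β V = V := by
  have hc := contracting_bellman (L := L) μ hβ
  refine ⟨_, ?_, hc.fixedPoint_isFixedPt⟩
  -- Value iteration from `0` stays in the closed set of convex functions.
  refine (isClosed_queueConvex L).mem_of_tendsto (hc.tendsto_iterate_fixedPoint 0)
    (Eventually.of_forall fun n => ?_)
  induction n with
  | zero => intro a q _; simp
  | succ n ih =>
    rw [Function.iterate_succ_apply']
    exact QueueConvex.bellman ih β.2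

end Bellman

/-! ### Reachability under feasible rates -/

/-- The state `y` can follow the state `z` under a feasible rate. -/
def Access (L : Link) (z y : L.State) : Prop :=
  0 < L.γ z.2 y.2 ∧ ∃ s, L.Feasible z.1 s ∧ y.1 = L.idx (z.1 - s + y.2)

/-- The state after a slot that left `u` packets in the queue, if `a` packets arrive. -/
def post (L : Link) (u : ℕ) (a : Fin (L.A + 1)) : L.State := (L.idx (u + a), a)

section Access

open Relation

variable {L : Link}

lemma exists_γ_pos (L : Link) (a : Fin (L.A + 1)) : ∃ a', 0 < L.γ a a' := by
  by_contra! h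
  have h1 := L.sum_γ a
  have h2 : ∑ a', L.γ a a' ≤ 0 := Finset.sum_nonpos fun a' _ => h a'
  linarith

lemma access_post {u v s : ℕ} {a a' : Fin (L.A + 1)} (hu : u + L.A ≤ L.Q) (hv : v + L.A ≤ L.Q)
    (hs : v + s = u + a) (hsS : s ≤ L.S) (hγ : 0 < L.γ a a') :
    L.Access (L.post u a) (L.post v a') := by
  have h : (L.idx (u + a) : ℕ) = u + a := idx_val (by omega)
  refine ⟨hγ, s, ?_, ?_⟩
  · simp only [post, h]
    exact ⟨by omega, by omega, hsS⟩
  · simp only [post, h]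
    congr 1
    omega

/-- Transmitting exactly what has just arrived, possible because `A ≤ S`, keeps the remainder at `u`
while the irreducible arrival chain moves to `a'`. -/
lemma reach_post_same {u : ℕ} (hu : u + L.A ≤ L.Q) (a a' : Fin (L.A + 1)) :
    ReflTransGen L.Access (L.post u a) (L.post u a') := by
  let _ := Matrix.toQuiver L.γ
  obtain ⟨p, -⟩ := L.γ_irreducible.connected a a'
  induction p with
  | nil => exact .refl
  | @cons b c p e ih =>
    have := L.A_le_S
    exact ih.tail (access_post hu hu rfl (by omega) e.down)

/-- Wait for a slot with one arrival and transmit nothing in it. In `reach_post_pred`, dually, one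
packet is sent in a slot without arrivals. -/
lemma reach_post_succ {u : ℕ} (hu : u + 1 + L.A ≤ L.Q) (a a' : Fin (L.A + 1)) :
    ReflTransGen L.Access (L.post u a) (L.post (u + 1) a') := by
  have hA := L.A_pos
  let b : Fin (L.A + 1) := ⟨1, by omega⟩
  obtain ⟨c, hc⟩ := L.exists_γ_pos b
  exact ((reach_post_same (by omega) a b).tail
    (access_post (v := u + 1) (s := 0) (by omega) hu (by simp [b]) (by omega) hc)).trans
    (reach_post_same hu c a')

lemma reach_post_pred {u : ℕ} (hu : u + 1 + L.A ≤ L.Q) (a a' : Fin (L.A + 1)) :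
    ReflTransGen L.Access (L.post (u + 1) a) (L.post u a') := by
  have hA := L.A_pos
  have hS := L.A_le_S
  obtain ⟨c, hc⟩ := L.exists_γ_pos 0
  exact ((reach_post_same hu a 0).tail
    (access_post (v := u) (s := 1) hu (by omega) (by simp) (by omega) hc)).trans
    (reach_post_same (by omega) c a')

lemma reach_post {u v : ℕ} (hu : u + L.A ≤ L.Q) (hv : v + L.A ≤ L.Q) (a a' : Fin (L.A + 1)) :
    ReflTransGen L.Access (L.post u a) (L.post v a') := by
  have down : ∀ u, u + L.A ≤ L.Q → ∀ a, ReflTransGen L.Access (L.post u a) (L.post 0 a) := by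
    intro u
    induction u with
    | zero => intro _ _; exact .refl
    | succ u ih => intro h a; exact (reach_post_pred h a a).trans (ih (by omega) a)
  have up : ∀ v, v + L.A ≤ L.Q → ∀ a, ReflTransGen L.Access (L.post 0 a) (L.post v a) := by
    intro v
    induction v with
    | zero => intro _ _; exact .refl
    | succ v ih => intro h a; exact (ih (by omega) a).trans (reach_post_succ h a a)
  exact ((down u hu a).trans (up v hv a)).trans (reach_post_same hv a a')

lemma reach_post_of_state (z : L.State) {u : ℕ} (hu : u + L.A ≤ L.Q) (a : Fin (L.A + 1)) :
    ReflTransGen L.Access z (L.post u a) := by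
  obtain ⟨c, hc⟩ := L.exists_γ_pos z.2
  have hf := feasible_min (L := L) (q := z.1) (by omega)
  have h1 : L.Access z (L.post (z.1 - min (z.1 : ℕ) L.S) c) := ⟨hc, _, hf, rfl⟩
  obtain ⟨h2, h3, -⟩ := hf
  exact (ReflTransGen.single h1).trans (reach_post (by omega) hu c a)

/-- A bound that propagates along accessible states holds at all of them. -/
lemma exists_bound_of_reach (C : ℝ) {z y : L.State} (h : ReflTransGen L.Access z y) :
    ∃ K, ∀ δ : L.State → ℝ, (∀ z y, L.Access z y → L.γ z.2 y.2 * δ y ≤ C + δ z) →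
      δ z = 0 → δ y ≤ K := by
  induction h with
  | refl => exact ⟨0, fun δ _ h => h.le⟩
  | @tail b c _ hbc ih =>
    obtain ⟨K, hK⟩ := ih
    refine ⟨(C + K) / L.γ b.2 c.2, fun δ hδ h0 => ?_⟩
    rw [le_div_iff₀ hbc.1, mul_comm]
    exact (hδ b c hbc).trans (by linarith [hK δ hδ h0])

/-- Only states of the form `post u a` are bounded: they can be reached from everywhere, while a
state with fewer packets queued than just arrived cannot. The constant must serve every `δ` at once,
whichever state `δ` vanishes at, hence the sum over all pairs. -/
lemma exists_bound_post (L : Link) (C : ℝ) :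
    ∃ K, 0 ≤ K ∧ ∀ δ : L.State → ℝ, (∀ z y, L.Access z y → L.γ z.2 y.2 * δ y ≤ C + δ z) →
      (∃ z, δ z = 0) → ∀ u a, u + L.A ≤ L.Q → δ (L.post u a) ≤ K := by
  have h : ∀ z y : L.State, ∃ K, ReflTransGen L.Access z y → ∀ δ : L.State → ℝ,
      (∀ z y, L.Access z y → L.γ z.2 y.2 * δ y ≤ C + δ z) → δ z = 0 → δ y ≤ K := by
    intro z y
    by_cases hzy : ReflTransGen L.Access z y
    · obtain ⟨K, hK⟩ := exists_bound_of_reach C hzy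
      exact ⟨K, fun _ => hK⟩
    · exact ⟨0, fun h => absurd h hzy⟩
  choose K hK using h
  refine ⟨∑ p : L.State × L.State, |K p.1 p.2|, Finset.sum_nonneg fun _ _ => abs_nonneg _, ?_⟩
  rintro δ hδ ⟨z, hz⟩ u a hu
  calc δ (L.post u a) ≤ K z (L.post u a) := hK _ _ (reach_post_of_state z hu a) δ hδ hz
    _ ≤ |K z (L.post u a)| := le_abs_self _
    _ ≤ _ := Finset.single_le_sum (f := fun p : L.State × L.State => |K p.1 p.2|)
        (fun _ _ => abs_nonneg _) (Finset.mem_univ (z, L.post u a))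

end Access

/-! ### Average-cost optimality equation by vanishing discount -/

section AverageCost

variable {L : Link} {μ : ℝ}

lemma cost_bounds (hμ : 0 ≤ μ) {z : L.State} {s : ℕ} (hs : L.Feasible z.1 s) :
    0 ≤ L.P s + μ * ((z.1 : ℕ) : ℝ) ∧
      L.P s + μ * ((z.1 : ℕ) : ℝ) ≤ L.P L.S + μ * L.Q := by
  have h1 := P_nonneg hs.2.2
  have h2 := P_le hs.2.2
  have h3 : ((z.1 : ℕ) : ℝ) ≤ L.Q := by exact_mod_cast Nat.lt_succ_iff.1 z.1.2
  have h4 := mul_le_mul_of_nonneg_left h3 hμ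
  exact ⟨by positivity, by linarith⟩

/-- Solutions of the discounted optimality equation have bounded span, uniformly in the
discount. -/
lemma exists_span_bound (L : Link) (hμ : 0 ≤ μ) :
    ∃ K, ∀ β : ℝ, 0 ≤ β → β < 1 → ∀ V : L.State → ℝ, L.bellman μ β V = V →
      ∃ M, (∀ z, V z ≤ M) ∧ (∀ z, M - K ≤ V z) ∧ 0 ≤ (1 - β) * M ∧
        (1 - β) * M ≤ L.P L.S + μ * L.Q := by
  set C := L.P L.S + μ * L.Q with hC
  have hC0 : 0 ≤ C := by
    have := P_nonneg (L := L) le_rfl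
    positivity
  obtain ⟨K, hK0, hK⟩ := exists_bound_post L C
  -- `K` bounds the gap to the maximum of `V` at the states `post u a`; `C` absorbs the loss `(1 -
  -- β) * M` in the one slot that leads there from an arbitrary state.
  refine ⟨C + K, fun β hβ0 hβ1 V hV => ?_⟩
  obtain ⟨zM, hM⟩ := Finite.exists_max V
  obtain ⟨zm, hm⟩ := Finite.exists_min V
  have hV0 : ∀ z, 0 ≤ V z := by
    obtain ⟨s, hs, e⟩ := exists_bellman_eq μ β V zm
    rw [hV] at e
    have h1 : V zm ≤ L.cont V zm.2 (zm.1 - s) := by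
      rw [← L.cont_const (V zm) zm.2 (zm.1 - s)]
      exact cont_mono hm _ _
    have h2 := mul_le_mul_of_nonneg_left h1 hβ0
    have h3 := (cost_bounds hμ hs).1
    have h4 : 0 ≤ V zm := by
      simp only [qval] at e
      by_contra! h
      nlinarith
    exact fun z => h4.trans (hm z)
  have hle : ∀ z s, L.Feasible z.1 s → V z ≤ C + β * L.cont V z.2 (z.1 - s) := by
    intro z s hs
    have h1 := bellman_le (μ := μ) (β := β) (V := V) z hs
    rw [hV] at h1
    simp only [qval] at h1
    linarith [(cost_bounds hμ hs).2]
  have hMC : (1 - β) * V zM ≤ C := by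
    obtain ⟨s, hs, -⟩ := exists_bellman_eq μ β V zM
    have h1 : L.cont V zM.2 (zM.1 - s) ≤ V zM := by
      rw [← L.cont_const (V zM) zM.2 (zM.1 - s)]
      exact cont_mono hM _ _
    have h2 := mul_le_mul_of_nonneg_left h1 hβ0
    linarith [hle zM s hs]
  refine ⟨V zM, hM, fun z => ?_, mul_nonneg (by linarith) (hV0 _), hMC⟩
  -- The gap to the maximum is nonnegative and propagates as required, because one slot costs at
  -- most `C`.
  have hpost := hK (fun z => V zM - V z) ?_ ⟨zM, sub_self _⟩
  · obtain ⟨s, hs, e⟩ := exists_bellman_eq μ β V z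
    rw [hV] at e
    have h1 : V zM - K ≤ L.cont V z.2 (z.1 - s) := by
      rw [← L.cont_const (V zM - K) z.2 (z.1 - s)]
      refine Finset.sum_le_sum fun a' _ => mul_le_mul_of_nonneg_left ?_ (L.γ_nonneg _ _)
      obtain ⟨h1, h2, -⟩ := hs
      have := hpost (z.1 - s) a' (by omega)
      simp only [post] at this
      linarith
    have h2 := mul_le_mul_of_nonneg_left h1 hβ0
    have h3 := (cost_bounds hμ hs).1
    have h4 : β * K ≤ K := mul_le_of_le_one_left hK0 hβ1.le
    simp only [qval] at e
    linarith
  · rintro z y ⟨hγ, s, hs, hy⟩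
    have h1 : L.cont (fun z => V zM - V z) z.2 (z.1 - s) = V zM - L.cont V z.2 (z.1 - s) := by
      rw [cont_sub, cont_const]
    have h2 : L.γ z.2 y.2 * (V zM - V y) ≤ L.cont (fun z => V zM - V z) z.2 (z.1 - s) := by
      have := Finset.single_le_sum
        (f := fun a' => L.γ z.2 a' * (V zM - V (L.idx (z.1 - s + a'), a')))
        (fun a' _ => mul_nonneg (L.γ_nonneg _ _) (sub_nonneg.2 (hM _))) (Finset.mem_univ y.2)
      simp only [← hy] at this
      exact this
    have h3 : 0 ≤ L.cont V z.2 (z.1 - s) := by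
      rw [← L.cont_const 0 z.2 (z.1 - s)]
      exact cont_mono hV0 _ _
    have h4 : β * L.cont V z.2 (z.1 - s) ≤ L.cont V z.2 (z.1 - s) :=
      mul_le_of_le_one_left h3 hβ1.le
    linarith [hle z s hs]

/-- The average-cost optimality equation has a solution that is convex in the queue length. -/
theorem exists_averageCost (L : Link) (hμ : 0 ≤ μ) :
    ∃ (g : ℝ) (h : L.State → ℝ), L.QueueConvex h ∧ ∀ z, g + h z = L.bellman μ 1 h z := by
  obtain ⟨K, hK⟩ := L.exists_span_bound hμ
  set C := L.P L.S + μ * L.Q with hC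
  let β : ℕ → NNReal := fun k => ⟨(k : ℝ) / (k + 1), by positivity⟩
  have hβval : ∀ k, (β k : ℝ) = (k : ℝ) / (k + 1) := fun k => rfl
  have hβ1 : ∀ k, (β k : ℝ) < 1 := fun k => by
    rw [hβval, div_lt_one (by positivity)]
    linarith
  have hβlim : Tendsto (fun k => (β k : ℝ)) atTop (𝓝 1) := tendsto_natCast_div_add_atTop (1 : ℝ)
  choose V hVc hV using fun k => L.exists_discounted μ (β := β k) (by exact_mod_cast hβ1 k)
  choose M hM1 hM2 hM3 hM4 using fun k => hK (β k) (β k).2 (hβ1 k) (V k) (hV k)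
  -- The values themselves may blow up as `β k → 1`; after subtracting `M k` they stay in a compact
  -- box, as does `g k`, and a limit point solves the undiscounted equation.
  let h : ℕ → L.State → ℝ := fun k z => V k z - M k
  let g : ℕ → ℝ := fun k => (1 - β k) * M k
  have heq : ∀ k z, g k + h k z = L.bellman μ (β k) (h k) z := by
    intro k z
    have h1 : ∀ s, L.qval μ (β k) (h k) z s = L.qval μ (β k) (V k) z s - β k * M k := by
      intro s
      simp only [qval, h, cont_sub, cont_const]
      ring
    have h2 : L.bellman μ (β k) (h k) z = L.bellman μ (β k) (V k) z - β k * M k := by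
      apply le_antisymm
      · obtain ⟨s, hs, e⟩ := exists_bellman_eq μ (β k) (V k) z
        rw [e, ← h1]
        exact bellman_le z hs
      · obtain ⟨s, hs, e⟩ := exists_bellman_eq μ (β k) (h k) z
        rw [e, h1]
        exact sub_le_sub_right (bellman_le z hs) _
    rw [h2, hV k]
    simp only [g, h]
    ring
  have hcpt : IsCompact (Set.Icc (0 : ℝ) C ×ˢ Set.Icc (fun _ : L.State => -K) (fun _ => 0)) :=
    isCompact_Icc.prod isCompact_Icc
  obtain ⟨⟨g', h'⟩, -, ms, hms, hlim⟩ := hcpt.tendsto_subseq (x := fun k => (g k, h k))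
    (fun k => ⟨⟨hM3 k, hM4 k⟩, fun z => by simp only [h]; linarith [hM2 k z],
      fun z => by simp only [h]; linarith [hM1 k z]⟩)
  have hg : Tendsto (fun k => g (ms k)) atTop (𝓝 g') := (continuous_fst.tendsto _).comp hlim
  have hh : Tendsto (fun k => h (ms k)) atTop (𝓝 h') := (continuous_snd.tendsto _).comp hlim
  have hhz : ∀ z, Tendsto (fun k => h (ms k) z) atTop (𝓝 (h' z)) := tendsto_pi_nhds.1 hh
  refine ⟨g', h', ?_, fun z => ?_⟩
  · refine (isClosed_queueConvex L).mem_of_tendsto hh (Eventually.of_forall fun k => ?_)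
    intro a q hq
    have := hVc (ms k) a q hq
    simp only [h]
    linarith
  · refine tendsto_nhds_unique (hg.add (hhz z)) ?_
    simp_rw [heq]
    refine Tendsto.finset_inf'_nhds_apply _ fun s _ => ?_
    refine tendsto_const_nhds.add ((hβlim.comp hms.tendsto_atTop).mul ?_)
    exact tendsto_finsetSum _ fun a' _ => tendsto_const_nhds.mul (hhz _)

end AverageCost

/-! ### Structure of the optimal rates -/

/-- `s` attains the minimum in the optimality equation with relative values `h`. -/
def IsOptRate (L : Link) (h : L.State → ℝ) (a : Fin (L.A + 1)) (q s : ℕ) : Prop :=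
  L.Feasible q s ∧ ∀ t, L.Feasible q t →
    L.P s + L.cont h a (q - s) ≤ L.P t + L.cont h a (q - t)

/-- Rate functions for which both the rate and the number of packets left grow with the queue. -/
def Regular (L : Link) (σ : ℕ → Fin (L.A + 1) → ℕ) : Prop :=
  ∀ a q, q + 1 ≤ L.Q → σ q a ≤ σ (q + 1) a ∧ σ (q + 1) a ≤ σ q a + 1

section OptRate

variable {L : Link} {h : L.State → ℝ} {a : Fin (L.A + 1)}

lemma exists_isOptRate (h : L.State → ℝ) (a : Fin (L.A + 1)) {q : ℕ} (hq : q ≤ L.Q) :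
    ∃ s, L.IsOptRate h a q s := by
  obtain ⟨s, hs, hmin⟩ := Finset.exists_min_image (L.rates q)
    (fun s => L.P s + L.cont h a (q - s)) ⟨_, mem_rates.2 (feasible_min hq)⟩
  exact ⟨s, mem_rates.1 hs, fun t ht => hmin t (mem_rates.2 ht)⟩

/-- The queue cost `μ * q` is common to all rates in a state, so it plays no role in the comparison
defining `IsOptRate`. -/
lemma IsOptRate.qval_eq {μ : ℝ} {z : L.State} {s : ℕ} (hs : L.IsOptRate h z.2 z.1 s) :
    L.qval μ 1 h z s = L.bellman μ 1 h z := by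
  apply le_antisymm
  · obtain ⟨t, ht, e⟩ := exists_bellman_eq μ 1 h z
    rw [e]
    have := hs.2 t ht
    simp only [qval]
    linarith
  · exact bellman_le z hs.1

lemma isOptRate_of_qval_le {μ : ℝ} {z : L.State} {s : ℕ} (hf : L.Feasible z.1 s)
    (hs : L.qval μ 1 h z s ≤ L.bellman μ 1 h z) : L.IsOptRate h z.2 z.1 s := by
  refine ⟨hf, fun t ht => ?_⟩
  have := hs.trans (bellman_le z ht)
  simp only [qval] at this
  linarith

/-- The total cost of two optimal rates is minimal, so a pair with no larger total must be optimal
in each component. -/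
lemma IsOptRate.exchange {q q' s s' t t' : ℕ} (hs : L.IsOptRate h a q s)
    (hs' : L.IsOptRate h a q' s') (ht : L.Feasible q t) (ht' : L.Feasible q' t')
    (hle : L.P t + L.P t' + (L.cont h a (q - t) + L.cont h a (q' - t')) ≤
      L.P s + L.P s' + (L.cont h a (q - s) + L.cont h a (q' - s'))) :
    L.IsOptRate h a q t ∧ L.IsOptRate h a q' t' := by
  have h1 := hs.2 t ht
  have h2 := hs'.2 t' ht'
  exact ⟨⟨ht, fun r hr => by linarith [hs.2 r hr]⟩, ⟨ht', fun r hr => by linarith [hs'.2 r hr]⟩⟩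

/-- Swapping inverted rates moves the two remainders towards each other, so convexity of `h`
applies. -/
lemma IsOptRate.swap_of_lt (hh : L.QueueConvex h) {q s s' : ℕ} (hs : L.IsOptRate h a q s)
    (hs' : L.IsOptRate h a (q + 1) s') (hlt : s' < s) :
    L.IsOptRate h a q s' ∧ L.IsOptRate h a (q + 1) s := by
  obtain ⟨h1, h2, h3⟩ := hs.1
  obtain ⟨h1', h2', h3'⟩ := hs'.1
  have hx := hh.cont_exchange a (u := q - s) (v := q + 1 - s') (by omega) (by omega)
  refine hs.exchange hs' ⟨by omega, by omega, h3'⟩ ⟨by omega, by omega, h3⟩ ?_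
  rw [show q - s' = q + 1 - s' - 1 by omega, show q + 1 - s = q - s + 1 by omega]
  linarith

/-- The new rates exchange the remainders between the two states and lie closer together, so
convexity of `P` alone suffices. -/
lemma IsOptRate.shift_of_lt {q s s' : ℕ} (hs : L.IsOptRate h a q s)
    (hs' : L.IsOptRate h a (q + 1) s') (hlt : s + 1 < s') :
    L.IsOptRate h a q (s' - 1) ∧ L.IsOptRate h a (q + 1) (s + 1) := by
  obtain ⟨h1, h2, h3⟩ := hs.1
  obtain ⟨h1', h2', h3'⟩ := hs'.1
  have hx := P_exchange (L := L) (s := s) (t := s') (by omega) h3'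
  refine hs.exchange hs' ⟨by omega, by omega, by omega⟩ ⟨by omega, by omega, by omega⟩ ?_
  rw [show q - (s' - 1) = q + 1 - s' by omega, show q + 1 - (s + 1) = q - s by omega]
  linarith

lemma IsOptRate.succ_of_lt (hh : L.QueueConvex h) {q s s' : ℕ} (hs : L.IsOptRate h a q s)
    (hs' : L.IsOptRate h a q s') (hlt : s < s') : L.IsOptRate h a q (s + 1) := by
  obtain ⟨h1, h2, h3⟩ := hs.1
  obtain ⟨h1', h2', h3'⟩ := hs'.1
  have hx := P_exchange (L := L) hlt h3'
  have hy := hh.cont_exchange a (u := q - s') (v := q - s) (by omega) (by omega)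
  refine (hs.exchange hs' (t := s + 1) (t' := s' - 1) ⟨by omega, by omega, by omega⟩
    ⟨by omega, by omega, by omega⟩ ?_).1
  rw [show q - (s + 1) = q - s - 1 by omega, show q - (s' - 1) = q - s' + 1 by omega]
  linarith

lemma IsOptRate.between (hh : L.QueueConvex h) {q s t s' : ℕ} (hs : L.IsOptRate h a q s)
    (hs' : L.IsOptRate h a q s') (h1 : s ≤ t) (h2 : t ≤ s') : L.IsOptRate h a q t := by
  induction t, h1 using Nat.le_induction with
  | base => exact hs
  | succ t _ ih => exact (ih (by omega)).succ_of_lt hh hs' (by omega)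

/-- The optimal rates form intervals whose end points are regular in the queue length. -/
lemma exists_optRate_interval (hh : L.QueueConvex h) :
    ∃ lo hi : ℕ → Fin (L.A + 1) → ℕ, L.Regular lo ∧ L.Regular hi ∧
      ∀ q ≤ L.Q, ∀ a s, L.IsOptRate h a q s ↔ lo q a ≤ s ∧ s ≤ hi q a := by
  classical
  have hex : ∀ q a, ∃ lo hi : ℕ, q ≤ L.Q → L.IsOptRate h a q lo ∧ L.IsOptRate h a q hi ∧
      ∀ s, L.IsOptRate h a q s → lo ≤ s ∧ s ≤ hi := by
    intro q a
    by_cases hq : q ≤ L.Q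
    · obtain ⟨s₀, hs₀⟩ := exists_isOptRate h a hq
      have hne : ((L.rates q).filter (L.IsOptRate h a q)).Nonempty :=
        ⟨s₀, Finset.mem_filter.2 ⟨mem_rates.2 hs₀.1, hs₀⟩⟩
      refine ⟨_, _, fun _ => ⟨(Finset.mem_filter.1 (Finset.min'_mem _ hne)).2,
        (Finset.mem_filter.1 (Finset.max'_mem _ hne)).2, fun s hs => ?_⟩⟩
      have hmem := Finset.mem_filter.2 ⟨mem_rates.2 hs.1, hs⟩
      exact ⟨Finset.min'_le _ _ hmem, Finset.le_max' _ _ hmem⟩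
    · exact ⟨0, 0, fun h => absurd h hq⟩
  choose lo hi H using hex
  refine ⟨lo, hi, fun a q hq => ⟨?_, ?_⟩, fun a q hq => ⟨?_, ?_⟩,
    fun q hq a s => ⟨fun hs => ?_, ?_⟩⟩
  · by_contra! hlt
    have := ((H q a (by omega)).1.swap_of_lt hh (H (q + 1) a hq).1 hlt).1
    have := ((H q a (by omega)).2.2 _ this).1
    omega
  · by_contra! hlt
    have := ((H q a (by omega)).1.shift_of_lt (H (q + 1) a hq).1 hlt).2
    have := ((H (q + 1) a hq).2.2 _ this).1
    omega
  · by_contra! hlt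
    have := ((H q a (by omega)).2.1.swap_of_lt hh (H (q + 1) a hq).2.1 hlt).2
    have := ((H (q + 1) a hq).2.2 _ this).2
    omega
  · by_contra! hlt
    have := ((H q a (by omega)).2.1.shift_of_lt (H (q + 1) a hq).2.1 hlt).1
    have := ((H q a (by omega)).2.2 _ this).2
    omega
  · exact (H q a hq).2.2 s hs
  · rintro ⟨h1, h2⟩
    exact (H q a hq).1.between hh (H q a hq).2.1 h1 h2

end OptRate

/-! ### Raising a regular rule in a single state -/

section Regular

variable {L : Link} {σ τ : ℕ → Fin (L.A + 1) → ℕ}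

lemma Regular.mono (hσ : L.Regular σ) (a : Fin (L.A + 1)) {q q' : ℕ} (h : q ≤ q')
    (hq' : q' ≤ L.Q) : σ q a ≤ σ q' a ∧ σ q' a ≤ σ q a + (q' - q) := by
  induction q', h using Nat.le_induction with
  | base => simp
  | succ n hn ih =>
    have h1 := ih (by omega)
    have h2 := hσ a n hq'
    omega

/-- Increase the rate by one in the state `(q₀, a₀)`. -/
def bump {B : Type*} [DecidableEq B] (σ : ℕ → B → ℕ) (q₀ : ℕ) (a₀ : B) : ℕ → B → ℕ :=
  fun q a => if q = q₀ ∧ a = a₀ then σ q a + 1 else σ q a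

/-- Take the first `k` where the gap `τ - σ` is largest, and let `q₀` be the right end of the
plateau of `σ` through `k`. Raising there respects the next value, since `σ` increases after `q₀`.
It respects the previous one because `σ` is flat just before `q₀`: if `k < q₀` by the choice of the
plateau, and if `k = q₀` because the gap grows strictly into `k` while `τ` grows by at most one. -/
lemma Regular.exists_bump (hσ : L.Regular σ) (hτ : L.Regular τ) {a : Fin (L.A + 1)} {q : ℕ}
    (hq : q ≤ L.Q) (hlt : σ q a < τ q a) :
    ∃ q₀ ≤ L.Q, σ q₀ a < τ q₀ a ∧ L.Regular (bump σ q₀ a) := by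
  obtain ⟨m, hm, hmax⟩ := Finset.exists_max_image (Finset.range (L.Q + 1))
    (fun q => (τ q a : ℤ) - σ q a) ⟨q, Finset.mem_range.2 (by omega)⟩
  have hex : ∃ n, n ≤ L.Q ∧ (τ m a : ℤ) - σ m a ≤ τ n a - σ n a :=
    ⟨m, Nat.lt_succ_iff.1 (Finset.mem_range.1 hm), le_rfl⟩
  classical
  obtain ⟨hkQ, hk⟩ := Nat.find_spec hex
  have hkmin : ∀ n < Nat.find hex, ¬ (n ≤ L.Q ∧ (τ m a : ℤ) - σ m a ≤ τ n a - σ n a) :=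
    fun n hn => Nat.find_min hex hn
  set k := Nat.find hex
  let q₀ := Nat.findGreatest (fun n => σ n a = σ k a) L.Q
  have h0 : σ q₀ a = σ k a := Nat.findGreatest_spec (P := fun n => σ n a = σ k a) hkQ rfl
  have hkq : k ≤ q₀ := Nat.le_findGreatest hkQ rfl
  have hqQ : q₀ ≤ L.Q := Nat.findGreatest_le _
  have hgr : ∀ n, q₀ < n → n ≤ L.Q → σ n a ≠ σ k a :=
    fun n h1 h2 => Nat.findGreatest_is_greatest (P := fun n => σ n a = σ k a) h1 h2
  have hmq := hmax q (Finset.mem_range.2 (by omega))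
  have hτm := (hτ.mono a hkq hqQ).1
  refine ⟨q₀, hqQ, by omega, fun b n hn => ?_⟩
  by_cases hb : b = a
  · subst hb
    have hn' := hσ b n hn
    simp only [bump, and_true]
    split_ifs with h1 h2 h2
    · omega
    · have := hgr (n + 1) (by omega) hn
      rw [h1] at hn' this ⊢
      omega
    · have hn0 : σ n b = σ (n + 1) b := by
        rcases Nat.lt_or_ge k q₀ with hlt' | hge
        · have h3 := (hσ.mono b (q := k) (q' := n) (by omega) (by omega)).1
          rw [← h2] at h0
          omega
        · have hkn : k = n + 1 := by omega
          have h4 := hkmin n (by omega)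
          have h5 := hτ b n hn
          rw [hkn] at hk
          omega
      omega
    · exact hn'
  · simp only [bump, hb, and_false, if_false]
    exact hσ b n hn

end Regular

/-! ### Mixtures of two rules and threshold policies -/

section Mixture

variable {L : Link} {σ τ : ℕ → Fin (L.A + 1) → ℕ}

lemma sum_ite_rate (L : Link) {n : ℕ} (hn : n ≤ L.S) (c : ℕ → ℝ) :
    ∑ s : Fin (L.S + 1), (if (s : ℕ) = n then 1 else 0) * c s = c n := by
  rw [Finset.sum_eq_single (⟨n, by omega⟩ : Fin (L.S + 1))]
  · simp
  · intro s _ hs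
    rw [if_neg, zero_mul]
    exact fun h => hs (Fin.ext h)
  · simp

/-- The policy that uses the rates `σ` with probability `1 - t` and `τ` with probability `t`. -/
def mixPolicy (L : Link) (σ τ : ℕ → Fin (L.A + 1) → ℕ)
    (hσ : ∀ q ≤ L.Q, ∀ a, L.Feasible q (σ q a)) (hτ : ∀ q ≤ L.Q, ∀ a, L.Feasible q (τ q a))
    (t : unitInterval) : L.Policy where
  prob q a s :=
    (1 - t) * (if (s : ℕ) = σ q a then 1 else 0) + t * (if (s : ℕ) = τ q a then 1 else 0)
  nonneg q a s := by
    have h1 := t.2.1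
    have h2 := t.2.2
    refine add_nonneg (mul_nonneg (by linarith) ?_) (mul_nonneg h1 ?_) <;> split_ifs <;> norm_num
  sum_eq_one q a := by
    have h1 := L.sum_ite_rate (hσ q (by omega) a).2.2 fun _ => 1
    have h2 := L.sum_ite_rate (hτ q (by omega) a).2.2 fun _ => 1
    simp only [mul_one] at h1 h2
    rw [Finset.sum_add_distrib, ← Finset.mul_sum, ← Finset.mul_sum, h1, h2]
    ring
  feasible q a s hs := by
    have h1 : (s : ℕ) ≠ σ q a := fun h => hs (h ▸ hσ q (by omega) a)
    have h2 : (s : ℕ) ≠ τ q a := fun h => hs (h ▸ hτ q (by omega) a)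
    simp [h1, h2]

lemma sum_mixPolicy_mul (hσ : ∀ q ≤ L.Q, ∀ a, L.Feasible q (σ q a))
    (hτ : ∀ q ≤ L.Q, ∀ a, L.Feasible q (τ q a)) (t : unitInterval) (z : L.State) (c : ℕ → ℝ) :
    ∑ s : Fin (L.S + 1), (L.mixPolicy σ τ hσ hτ t).prob z.1 z.2 s * c s =
      (1 - t) * c (σ z.1 z.2) + t * c (τ z.1 z.2) := by
  have h1 := L.sum_ite_rate (hσ z.1 (by omega) z.2).2.2 c
  have h2 := L.sum_ite_rate (hτ z.1 (by omega) z.2).2.2 c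
  rw [← h1, ← h2, Finset.mul_sum, Finset.mul_sum, ← Finset.sum_add_distrib]
  refine Finset.sum_congr rfl fun s _ => ?_
  simp only [mixPolicy]
  ring

end Mixture

section Threshold

variable {L : Link} {σ : ℕ → Fin (L.A + 1) → ℕ}

/-- The largest queue length at which the rate is at most `s`. -/
def threshold (L : Link) (σ : ℕ → Fin (L.A + 1) → ℕ) (s : ℤ) (a : Fin (L.A + 1)) : ℤ :=
  (((Finset.range (L.Q + 1)).filter fun q => (σ q a : ℤ) ≤ s).card : ℤ) - 1

/-- As `σ` is nondecreasing in the queue, the counted set is an initial segment, and its cardinality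
is one more than its largest element. -/
lemma Regular.le_threshold_iff (hσ : L.Regular σ) {q : ℕ} (hq : q ≤ L.Q) (s : ℤ)
    (a : Fin (L.A + 1)) : (q : ℤ) ≤ L.threshold σ s a ↔ (σ q a : ℤ) ≤ s := by
  constructor
  · intro h
    by_contra hs
    have hsub : ((Finset.range (L.Q + 1)).filter fun q => (σ q a : ℤ) ≤ s) ⊆ Finset.range q := by
      intro n hn
      rw [Finset.mem_filter, Finset.mem_range] at hn
      rw [Finset.mem_range]
      by_contra hqn
      have := (hσ.mono a (q := q) (q' := n) (by omega) (by omega)).1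
      omega
    have := Finset.card_le_card hsub
    rw [Finset.card_range] at this
    rw [threshold] at h
    omega
  · intro h
    have hsub : Finset.range (q + 1) ⊆
        (Finset.range (L.Q + 1)).filter fun q => (σ q a : ℤ) ≤ s := by
      intro n hn
      rw [Finset.mem_range] at hn
      rw [Finset.mem_filter, Finset.mem_range]
      have := (hσ.mono a (q := n) (q' := q) (by omega) hq).1
      omega
    have := Finset.card_le_card hsub
    rw [Finset.card_range] at this
    rw [threshold]
    omega

lemma threshold_le (L : Link) (σ : ℕ → Fin (L.A + 1) → ℕ) (s : ℤ) (a : Fin (L.A + 1)) :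
    L.threshold σ s a ≤ L.Q := by
  have := Finset.card_filter_le (Finset.range (L.Q + 1)) fun q => (σ q a : ℤ) ≤ s
  rw [Finset.card_range] at this
  rw [threshold]
  omega

/-- A policy that follows a regular rate function, except for a randomization between two
consecutive rates in the last state with the lower one, is a threshold policy. -/
lemma Regular.isThreshold (hσ : L.Regular σ) (hf : ∀ q ≤ L.Q, ∀ a, L.Feasible q (σ q a))
    {F : L.Policy} {q₀ : Fin (L.Q + 1)} {a₀ : Fin (L.A + 1)}
    (hlast : ∀ q : ℕ, q₀ < q → q ≤ L.Q → σ q₀ a₀ < σ q a₀) (hS : σ q₀ a₀ < L.S)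
    (hF : ∀ q a s, ¬ (q = q₀ ∧ a = a₀) → F.prob q a s = if (s : ℕ) = σ q a then 1 else 0)
    (hF₀ : ∀ s : Fin (L.S + 1), (s : ℕ) ≠ σ q₀ a₀ → (s : ℕ) ≠ σ q₀ a₀ + 1 → F.prob q₀ a₀ s = 0) :
    F.IsThreshold (L.threshold σ) ⟨σ q₀ a₀, hS⟩ a₀ := by
  have key : ∀ (q : Fin (L.Q + 1)) (a : Fin (L.A + 1)) (s : ℤ),
      ((q : ℕ) : ℤ) ≤ L.threshold σ s a ↔ (σ q a : ℤ) ≤ s :=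
    fun q a s => hσ.le_threshold_iff (by omega) s a
  have hq₀ : L.threshold σ (σ q₀ a₀ : ℕ) a₀ = ((q₀ : ℕ) : ℤ) := by
    apply le_antisymm
    · by_contra! h
      have h1 := L.threshold_le σ (σ q₀ a₀ : ℕ) a₀
      have h2 := (hσ.le_threshold_iff (q := q₀ + 1) (by omega) (σ q₀ a₀ : ℕ) a₀).1 (by omega)
      have h3 := hlast (q₀ + 1) (by omega) (by omega)
      omega
    · exact (key _ _ _).2 le_rfl
  have eq_of : ∀ (q : Fin (L.Q + 1)) (a : Fin (L.A + 1)) (s : ℕ),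
      L.threshold σ ((s : ℤ) - 1) a < ((q : ℕ) : ℤ) → ((q : ℕ) : ℤ) ≤ L.threshold σ (s : ℤ) a →
      s = σ q a := by
    intro q a s h1 h2
    rw [← not_le, key] at h1
    rw [key] at h2
    omega
  refine ⟨fun a => ?_, fun a => ?_, fun a s _ => ?_, fun a => L.threshold_le σ _ a,
    fun q a s hne h1 h2 => ?_, fun q h1 h2 => ?_, fun q hq => ?_, fun q a s h1 h2 => ?_⟩
  · have : ((Finset.range (L.Q + 1)).filter fun q => (σ q a : ℤ) ≤ -1) = ∅ :=
      Finset.filter_eq_empty_iff.2 fun q _ => by omega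
    simp [threshold, this]
  · have h0 := (hf 0 (by omega) a).2.1
    exact (hσ.le_threshold_iff (q := 0) (by omega) 0 a).2 (by omega)
  · have hsub : ((Finset.range (L.Q + 1)).filter fun q => (σ q a : ℤ) ≤ s) ⊆
        (Finset.range (L.Q + 1)).filter fun q => (σ q a : ℤ) ≤ (s : ℤ) + 1 :=
      Finset.monotone_filter_right _ fun q _ h => by omega
    have := Finset.card_le_card hsub
    simp only [threshold]
    omega
  · have hs := eq_of q a s h1 h2
    rw [hF, if_pos hs]
    rintro ⟨rfl, rfl⟩
    rcases hne with h | h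
    · exact h rfl
    · exact h (Fin.ext hs)
  · have hs := eq_of q a₀ _ h1 h2.le
    refine (hF _ _ _ ?_).trans (if_pos hs)
    rintro ⟨rfl, -⟩
    rw [hq₀] at h2
    exact lt_irrefl _ h2
  · rw [hq₀] at hq
    obtain rfl : q = q₀ := Fin.ext (by exact_mod_cast hq)
    rw [← F.sum_eq_one q a₀]
    refine (Fintype.sum_eq_add _ _ ?_ fun s hs => ?_).symm
    · exact (Fin.castSucc_lt_succ).ne
    · refine hF₀ s (fun h => hs.1 (Fin.ext h)) (fun h => hs.2 (Fin.ext h))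
  · rw [hq₀] at h2
    have hs : (s : ℕ) ≠ σ q a := by
      intro h
      refine h1 ⟨?_, (key _ _ _).2 (by omega)⟩
      rw [← not_le, key]
      omega
    by_cases hqa : q = q₀ ∧ a = a₀
    · obtain ⟨rfl, rfl⟩ := hqa
      exact hF₀ s hs fun h => h2 ⟨rfl, rfl, Or.inr (Fin.ext h)⟩
    · rw [hF q a s hqa, if_neg hs]

end Threshold

/-! ### Regular mixtures: all stationary laws have the same power -/

/-- Monotonicity in the queue length. -/
def QueueMono (L : Link) (f : L.State → ℝ) : Prop :=
  ∀ (a : Fin (L.A + 1)) (q q' : Fin (L.Q + 1)), q ≤ q' → f (q, a) ≤ f (q', a)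

/-- The queue length as a function of the state. -/
def queue (L : Link) (z : L.State) : ℝ := ((z.1 : ℕ) : ℝ)

lemma queueMono_queue (L : Link) : L.QueueMono L.queue := fun _ _ _ h => by
  simpa [queue] using h

lemma idx_mono (L : Link) {m n : ℕ} (h : m ≤ n) : L.idx m ≤ L.idx n := by
  simp only [idx, Fin.mk_le_mk]
  omega

lemma QueueMono.cont_le {L : Link} {f : L.State → ℝ} (hf : L.QueueMono f) (a : Fin (L.A + 1))
    {u v : ℕ} (h : u ≤ v) : L.cont f a u ≤ L.cont f a v :=
  Finset.sum_le_sum fun a' _ =>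
    mul_le_mul_of_nonneg_left (hf _ _ _ (L.idx_mono (by omega))) (L.γ_nonneg _ _)

/-- The expected number of arrivals in the next slot. -/
def nextArrival (L : Link) (a : Fin (L.A + 1)) : ℝ := ∑ a', L.γ a a' * ((a' : ℕ) : ℝ)

lemma cont_queue {L : Link} {q s : ℕ} (hs : L.Feasible q s) (a : Fin (L.A + 1)) :
    L.cont L.queue a (q - s) = (q : ℝ) - s + L.nextArrival a := by
  have h : ∀ a' : Fin (L.A + 1), L.queue (L.idx (q - s + a'), a') = ((q : ℝ) - s) + (a' : ℕ) := by
    intro a'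
    rw [queue, idx_val (hs.sub_add_le a'), Nat.cast_add, Nat.cast_sub hs.2.1]
  simp only [cont, h, mul_add, Finset.sum_add_distrib, ← Finset.sum_mul, L.sum_γ, one_mul,
    nextArrival]

/-- The arrivals form a Markov chain of their own, whatever the policy. -/
lemma Policy.trans_pow_mulVec_arrival {L : Link} (F : L.Policy) (f : Fin (L.A + 1) → ℝ) (n : ℕ)
    (z : L.State) : (F.trans ^ n *ᵥ fun z => f z.2) z = (L.γ ^ n *ᵥ f) z.2 := by
  induction n generalizing z with
  | zero => simp
  | succ n ih =>
    rw [pow_succ', ← Matrix.mulVec_mulVec, pow_succ', ← Matrix.mulVec_mulVec, F.trans_mulVec]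
    have h : ∀ u, L.cont (F.trans ^ n *ᵥ fun z => f z.2) z.2 u = (L.γ *ᵥ (L.γ ^ n *ᵥ f)) z.2 := by
      intro u
      simp only [cont, ih]
      rfl
    simp only [h, ← Finset.sum_mul, F.sum_eq_one, one_mul]

lemma avgPower_freq {L : Link} (F : L.Policy) (π : L.State → ℝ) :
    L.avgPower (F.freq π) = π ⬝ᵥ F.slotPower := by
  rw [avgPower_eq_mean, mean_freq]
  rfl

lemma avgDelay_freq {L : Link} (F : L.Policy) (π : L.State → ℝ) :
    L.avgDelay (F.freq π) = (1 / L.α) * (π ⬝ᵥ L.queue) := by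
  rw [avgDelay_eq_mean, mean_freq_state F π fun z => ((z.1 : ℕ) : ℝ)]
  rfl

section RegularMixture

variable {L : Link} {σ τ : ℕ → Fin (L.A + 1) → ℕ}
  {hσf : ∀ q ≤ L.Q, ∀ a, L.Feasible q (σ q a)} {hτf : ∀ q ≤ L.Q, ∀ a, L.Feasible q (τ q a)}
  {t : unitInterval}

lemma mixPolicy_trans_mulVec (f : L.State → ℝ) (z : L.State) :
    ((L.mixPolicy σ τ hσf hτf t).trans *ᵥ f) z =
      (1 - t) * L.cont f z.2 (z.1 - σ z.1 z.2) + t * L.cont f z.2 (z.1 - τ z.1 z.2) := by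
  rw [Policy.trans_mulVec]
  exact sum_mixPolicy_mul hσf hτf t z fun s => L.cont f z.2 (z.1 - s)

lemma mixPolicy_slotPower (z : L.State) :
    (L.mixPolicy σ τ hσf hτf t).slotPower z =
      (1 - t) * L.P (σ z.1 z.2) + t * L.P (τ z.1 z.2) :=
  sum_mixPolicy_mul hσf hτf t z L.P

/-- Stochastic monotonicity: for a regular rule the remainder `q - σ q a` is nondecreasing in `q`.
-/
lemma QueueMono.mixPolicy_trans (hσ : L.Regular σ) (hτ : L.Regular τ) {f : L.State → ℝ}
    (hf : L.QueueMono f) :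
    L.QueueMono ((L.mixPolicy σ τ hσf hτf t).trans *ᵥ f) := by
  intro a q q' hq
  rw [mixPolicy_trans_mulVec, mixPolicy_trans_mulVec]
  have hq' : (q : ℕ) ≤ q' := hq
  have h1 := (hσ.mono a hq' (by omega)).2
  have h2 := (hτ.mono a hq' (by omega)).2
  have h3 := (hσf q (by omega) a).2.1
  have h4 := (hτf q (by omega) a).2.1
  have t1 := t.2.1
  have t2 := t.2.2
  exact add_le_add
    (mul_le_mul_of_nonneg_left (hf.cont_le a (by simp only; omega)) (by linarith))
    (mul_le_mul_of_nonneg_left (hf.cont_le a (by simp only; omega)) t1)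

lemma QueueMono.mixPolicy_trans_pow (hσ : L.Regular σ) (hτ : L.Regular τ) {f : L.State → ℝ}
    (hf : L.QueueMono f) (n : ℕ) :
    L.QueueMono ((L.mixPolicy σ τ hσf hτf t).trans ^ n *ᵥ f) := by
  induction n with
  | zero => simpa using hf
  | succ n ih =>
    rw [pow_succ', ← Matrix.mulVec_mulVec]
    exact ih.mixPolicy_trans hσ hτ

/-- The expected rate of a mixture. -/
def mixRate (L : Link) (σ τ : ℕ → Fin (L.A + 1) → ℕ) (t : ℝ) (z : L.State) : ℝ :=
  (1 - t) * σ z.1 z.2 + t * τ z.1 z.2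

lemma mixPolicy_trans_queue (z : L.State) :
    ((L.mixPolicy σ τ hσf hτf t).trans *ᵥ L.queue) z =
      L.queue z - L.mixRate σ τ t z + L.nextArrival z.2 := by
  rw [mixPolicy_trans_mulVec, cont_queue (hσf z.1 (by omega) z.2),
    cont_queue (hτf z.1 (by omega) z.2), queue, mixRate]
  ring

lemma P_sub_le {m n : ℕ} (hmn : m ≤ n) (hn : n ≤ L.S) :
    L.P n - L.P m ≤ L.P L.S * ((n : ℝ) - m) := by
  rcases hmn.eq_or_lt with rfl | hlt
  · simp
  · have h1 : (1 : ℝ) ≤ (n : ℝ) - m := by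
      have : ((m + 1 : ℕ) : ℝ) ≤ n := by exact_mod_cast hlt
      push_cast at this
      linarith
    have h2 := P_nonneg (L := L) (s := m) (by omega)
    have h3 := P_le hn
    have h4 := P_nonneg (L := L) le_rfl
    nlinarith

lemma queueMono_slotPower (hσ : L.Regular σ) (hτ : L.Regular τ) :
    L.QueueMono (L.mixPolicy σ τ hσf hτf t).slotPower := by
  intro a q q' hq
  rw [mixPolicy_slotPower, mixPolicy_slotPower]
  have h1 := L.P_mono (Set.mem_Iic.2 (hσf q (by omega) a).2.2)
    (Set.mem_Iic.2 (hσf q' (by omega) a).2.2) (hσ.mono a (Fin.le_def.1 hq) (by omega)).1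
  have h2 := L.P_mono (Set.mem_Iic.2 (hτf q (by omega) a).2.2)
    (Set.mem_Iic.2 (hτf q' (by omega) a).2.2) (hτ.mono a (Fin.le_def.1 hq) (by omega)).1
  have t1 := t.2.1
  have t2 := t.2.2
  exact add_le_add (mul_le_mul_of_nonneg_left h1 (by linarith)) (mul_le_mul_of_nonneg_left h2 t1)

/-- Differences in power are thus controlled by differences in rate, which sum up exactly by
conservation of packets. The crude Lipschitz constant `P S` is enough. -/
lemma queueMono_rate_sub_slotPower (hσ : L.Regular σ) (hτ : L.Regular τ) :
    L.QueueMono (L.P L.S • L.mixRate σ τ t - (L.mixPolicy σ τ hσf hτf t).slotPower) := by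
  intro a q q' hq
  simp only [Pi.sub_apply, Pi.smul_apply, smul_eq_mul, mixPolicy_slotPower, mixRate]
  have h1 := P_sub_le (hσ.mono a (Fin.le_def.1 hq) (by omega)).1 (hσf q' (by omega) a).2.2
  have h2 := P_sub_le (hτ.mono a (Fin.le_def.1 hq) (by omega)).1 (hτf q' (by omega) a).2.2
  have t1 : (0 : ℝ) ≤ t := t.2.1
  have t2 : (0 : ℝ) ≤ 1 - t := sub_nonneg.2 t.2.2
  have h3 := mul_le_mul_of_nonneg_left h1 t2
  have h4 := mul_le_mul_of_nonneg_left h2 t1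
  linarith

/-- Conservation of packets: what is sent equals the initial queue minus the final queue plus the
arrivals, and the last term does not depend on the initial queue. -/
lemma sum_trans_pow_mixRate (n : ℕ) (z : L.State) :
    ∑ k ∈ Finset.range n, ((L.mixPolicy σ τ hσf hτf t).trans ^ k *ᵥ L.mixRate σ τ t) z =
      L.queue z - ((L.mixPolicy σ τ hσf hτf t).trans ^ n *ᵥ L.queue) z +
        ∑ k ∈ Finset.range n, (L.γ ^ k *ᵥ L.nextArrival) z.2 := by
  induction n with
  | zero => simp
  | succ n ih =>
    have h : (L.mixPolicy σ τ hσf hτf t).trans *ᵥ L.queue =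
        L.queue - L.mixRate σ τ t + fun z => L.nextArrival z.2 := by
      funext y
      exact mixPolicy_trans_queue y
    rw [Finset.sum_range_succ, Finset.sum_range_succ, ih, pow_succ, ← Matrix.mulVec_mulVec, h,
      Matrix.mulVec_add, Matrix.mulVec_sub]
    simp only [Pi.add_apply, Pi.sub_apply, Policy.trans_pow_mulVec_arrival]
    ring

/-- Total power over `n` slots depends on the initial queue length only up to a constant. -/
lemma sum_trans_pow_slotPower_bounds (hσ : L.Regular σ) (hτ : L.Regular τ) (n : ℕ)
    (z : L.State) :
    ∑ k ∈ Finset.range n, ((L.mixPolicy σ τ hσf hτf t).trans ^ k *ᵥ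
        (L.mixPolicy σ τ hσf hτf t).slotPower) (0, z.2) ≤
      ∑ k ∈ Finset.range n, ((L.mixPolicy σ τ hσf hτf t).trans ^ k *ᵥ
        (L.mixPolicy σ τ hσf hτf t).slotPower) z ∧
    ∑ k ∈ Finset.range n, ((L.mixPolicy σ τ hσf hτf t).trans ^ k *ᵥ
        (L.mixPolicy σ τ hσf hτf t).slotPower) z ≤
      ∑ k ∈ Finset.range n, ((L.mixPolicy σ τ hσf hτf t).trans ^ k *ᵥ
        (L.mixPolicy σ τ hσf hτf t).slotPower) (0, z.2) + L.P L.S * L.Q := by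
  set F := L.mixPolicy σ τ hσf hτf t with hF
  obtain ⟨q, a⟩ := z
  have hz : (0 : Fin (L.Q + 1)) ≤ q := Fin.zero_le _
  refine ⟨Finset.sum_le_sum fun k _ =>
    (queueMono_slotPower hσ hτ).mixPolicy_trans_pow hσ hτ k a 0 q hz, ?_⟩
  have h1 : ∀ k ∈ Finset.range n, (F.trans ^ k *ᵥ F.slotPower) (q, a) ≤
      (F.trans ^ k *ᵥ F.slotPower) (0, a) + L.P L.S * ((F.trans ^ k *ᵥ L.mixRate σ τ t) (q, a) -
        (F.trans ^ k *ᵥ L.mixRate σ τ t) (0, a)) := by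
    intro k _
    have := (queueMono_rate_sub_slotPower (hσf := hσf) (hτf := hτf) (t := t)
      hσ hτ).mixPolicy_trans_pow (hσf := hσf) (hτf := hτf) (t := t) hσ hτ k a 0 q hz
    simp only [Matrix.mulVec_sub, Matrix.mulVec_smul, Pi.sub_apply, Pi.smul_apply,
      smul_eq_mul, ← hF] at this
    linarith
  refine (Finset.sum_le_sum h1).trans ?_
  rw [Finset.sum_add_distrib, ← Finset.mul_sum, Finset.sum_sub_distrib,
    sum_trans_pow_mixRate, sum_trans_pow_mixRate]
  -- The arrivals cancel. The final queue is at least as long from `q` as from `0`, so the excess of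
  -- transmitted packets is at most `q ≤ Q`.
  refine add_le_add_right (mul_le_mul_of_nonneg_left ?_ (P_nonneg le_rfl)) _
  have h2 := L.queueMono_queue.mixPolicy_trans_pow (hσf := hσf) (hτf := hτf) (t := t)
    hσ hτ n a 0 q hz
  have h3 : L.queue (q, a) ≤ L.Q := by
    simpa [queue] using Nat.lt_succ_iff.1 q.2
  have h4 : L.queue (0, a) = 0 := by simp [queue]
  simp only
  linarith

lemma Policy.IsStationary.dotProduct_arrival {F : L.Policy} {π : L.State → ℝ}
    (h : F.IsStationary π) (f : Fin (L.A + 1) → ℝ) :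
    π ⬝ᵥ (fun z => f z.2) = ∑ a, L.φ a * f a := by
  rw [← h.isFrequency.mean_arrival, mean_freq_state F π fun z => f z.2]

/-- All stationary laws of a mixture of regular rate functions have the same power. -/
lemma mixPolicy_power_unique (hσ : L.Regular σ) (hτ : L.Regular τ) {π ν : L.State → ℝ}
    (hπ : (L.mixPolicy σ τ hσf hτf t).IsStationary π)
    (hν : (L.mixPolicy σ τ hσf hτf t).IsStationary ν) :
    π ⬝ᵥ (L.mixPolicy σ τ hσf hτf t).slotPower = ν ⬝ᵥ (L.mixPolicy σ τ hσf hτf t).slotPower := by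
  have hb := fun n z => sum_trans_pow_slotPower_bounds (hσf := hσf) (hτf := hτf) (t := t) hσ hτ n z
  set F := L.mixPolicy σ τ hσf hτf t
  let G : ℕ → L.State → ℝ := fun n z => ∑ k ∈ Finset.range n, (F.trans ^ k *ᵥ F.slotPower) z
  have hdot : ∀ {ρ : L.State → ℝ}, F.IsStationary ρ → ∀ n : ℕ,
      ρ ⬝ᵥ G n = n * (ρ ⬝ᵥ F.slotPower) := by
    intro ρ hρ n
    have : G n = ∑ k ∈ Finset.range n, F.trans ^ k *ᵥ F.slotPower := by
      funext z
      simp [G]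
    rw [this, dotProduct_sum]
    simp [Markov.dotProduct_pow_mulVec hρ.2]
  -- Every stationary law has arrival marginal `φ`. Hence `n` times its power lies within a bounded
  -- distance of a quantity independent of the law, and large `n` forces equality.
  have hlow : ∀ {ρ : L.State → ℝ}, F.IsStationary ρ → ∀ n : ℕ,
      ∑ a, L.φ a * G n (0, a) ≤ n * (ρ ⬝ᵥ F.slotPower) := by
    intro ρ hρ n
    rw [← hdot hρ, ← hρ.dotProduct_arrival fun a => G n (0, a)]
    exact Finset.sum_le_sum fun z _ => mul_le_mul_of_nonneg_left (hb n z).1 (hρ.1.1 z)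
  have hup : ∀ {ρ : L.State → ℝ}, F.IsStationary ρ → ∀ n : ℕ,
      n * (ρ ⬝ᵥ F.slotPower) ≤ ∑ a, L.φ a * G n (0, a) + L.P L.S * L.Q := by
    intro ρ hρ n
    have h1 : ∑ z, ρ z * (L.P L.S * L.Q) = L.P L.S * L.Q := by
      rw [← Finset.sum_mul, hρ.1.2, one_mul]
    rw [← hdot hρ, ← hρ.dotProduct_arrival fun a => G n (0, a), ← h1]
    simp only [dotProduct, ← Finset.sum_add_distrib, ← mul_add]
    exact Finset.sum_le_sum fun z _ => mul_le_mul_of_nonneg_left (hb n z).2 (hρ.1.1 z)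
  have hle : ∀ {ρ ρ' : L.State → ℝ}, F.IsStationary ρ → F.IsStationary ρ' →
      ρ ⬝ᵥ F.slotPower ≤ ρ' ⬝ᵥ F.slotPower := by
    intro ρ ρ' hρ hρ'
    by_contra! hlt
    obtain ⟨n, hn⟩ := exists_nat_gt (L.P L.S * L.Q / (ρ ⬝ᵥ F.slotPower - ρ' ⬝ᵥ F.slotPower))
    rw [div_lt_iff₀ (sub_pos.2 hlt)] at hn
    have h1 := hup hρ n
    have h2 := hlow hρ' n
    linarith
  exact le_antisymm (hle hπ hν) (hle hν hπ)

end RegularMixture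

/-! ### Comparison of queue lengths -/

section Domination

variable {L : Link} {σ : ℕ → Fin (L.A + 1) → ℕ}
  {x : Fin (L.Q + 1) → Fin (L.A + 1) → Fin (L.S + 1) → ℝ}

/-- The policy with deterministic rates `σ`. -/
abbrev rulePolicy (L : Link) (σ : ℕ → Fin (L.A + 1) → ℕ)
    (hσ : ∀ q ≤ L.Q, ∀ a, L.Feasible q (σ q a)) : L.Policy := L.mixPolicy σ σ hσ hσ 0

lemma rulePolicy_trans_mulVec (hσf : ∀ q ≤ L.Q, ∀ a, L.Feasible q (σ q a)) (f : L.State → ℝ)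
    (z : L.State) :
    ((L.rulePolicy σ hσf).trans *ᵥ f) z = L.cont f z.2 (z.1 - σ z.1 z.2) := by
  simp [mixPolicy_trans_mulVec]

lemma IsFrequency.law_mem_stdSimplex (hx : L.IsFrequency x) :
    (fun z : L.State => ∑ s, x z.1 z.2 s) ∈ stdSimplex ℝ L.State :=
  ⟨fun z => Finset.sum_nonneg fun s _ => hx.nonneg _ _ _, by
    rw [Fintype.sum_prod_type]; exact hx.sum_eq_one⟩

lemma law_dotProduct (f : L.State → ℝ) :
    (fun z : L.State => ∑ s, x z.1 z.2 s) ⬝ᵥ f = L.mean x fun z _ => f z := by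
  simp only [dotProduct, Fintype.sum_prod_type, mean, Finset.sum_mul]

/-- Smaller rates lead to longer queues. -/
lemma exists_stationary_queue_ge (hx : L.IsFrequency x) (hσ : L.Regular σ)
    (hσf : ∀ q ≤ L.Q, ∀ a, L.Feasible q (σ q a))
    (hle : ∀ (z : L.State) (s : Fin (L.S + 1)), x z.1 z.2 s ≠ 0 → σ z.1 z.2 ≤ s) :
    ∃ π, (L.rulePolicy σ hσf).IsStationary π ∧
      L.mean x (fun z _ => L.queue z) ≤ π ⬝ᵥ L.queue := by
  set F := L.rulePolicy σ hσf with hF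
  obtain ⟨π, h1, h2, h3⟩ := Markov.exists_stationary_ge F.trans_mem_rowStochastic
    hx.law_mem_stdSimplex (f := L.queue) (m := L.mean x fun z _ => L.queue z) (fun n => by
      rw [law_dotProduct]
      induction n with
      | zero => simp
      | succ n ih =>
        refine ih.trans ?_
        rw [pow_succ', ← Matrix.mulVec_mulVec, ← mean_cont hx]
        -- Start the rule from the law of `x`. By balance, replacing the rates of `x` by the smaller
        -- rates of `σ` for one more slot can only lengthen the queue, so the mean stays above its
        -- initial value at all times.
        refine mean_mono hx fun z s h0 hs => ?_
        rw [hF, rulePolicy_trans_mulVec]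
        have := hle z s h0
        exact (L.queueMono_queue.mixPolicy_trans_pow hσ hσ n).cont_le _ (by omega))
  exact ⟨π, ⟨h1, h2⟩, h3⟩

/-- Larger rates lead to shorter queues. -/
lemma exists_stationary_queue_le (hx : L.IsFrequency x) (hσ : L.Regular σ)
    (hσf : ∀ q ≤ L.Q, ∀ a, L.Feasible q (σ q a))
    (hle : ∀ (z : L.State) (s : Fin (L.S + 1)), x z.1 z.2 s ≠ 0 → (s : ℕ) ≤ σ z.1 z.2) :
    ∃ π, (L.rulePolicy σ hσf).IsStationary π ∧
      π ⬝ᵥ L.queue ≤ L.mean x (fun z _ => L.queue z) := by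
  set F := L.rulePolicy σ hσf with hF
  obtain ⟨π, h1, h2, h3⟩ := Markov.exists_stationary_ge F.trans_mem_rowStochastic
    hx.law_mem_stdSimplex (f := -L.queue) (m := -L.mean x fun z _ => L.queue z) (fun n => by
      rw [Matrix.mulVec_neg, dotProduct_neg, neg_le_neg_iff, law_dotProduct]
      induction n with
      | zero => simp
      | succ n ih =>
        refine le_trans ?_ ih
        rw [pow_succ', ← Matrix.mulVec_mulVec, ← mean_cont hx (F.trans ^ n *ᵥ L.queue)]
        refine mean_mono hx fun z s h0 hs => ?_
        rw [hF, rulePolicy_trans_mulVec]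
        have := hle z s h0
        exact (L.queueMono_queue.mixPolicy_trans_pow hσ hσ n).cont_le _ (by omega))
  rw [dotProduct_neg, neg_le_neg_iff] at h3
  exact ⟨π, ⟨h1, h2⟩, h3⟩

end Domination

/-! ### Verification: least cost means optimal rates -/

section Cost

variable {L : Link} {μ g : ℝ} {h : L.State → ℝ}
  {x : Fin (L.Q + 1) → Fin (L.A + 1) → Fin (L.S + 1) → ℝ}

/-- The relative values cancel by the balance equations, so the mean defect in the optimality
equation is the excess of the cost over `g`. Its sign gives `le_cost`, and its vanishing
characterizes the minimizers. -/
lemma mean_qval_sub (hx : L.IsFrequency x) (μ g : ℝ) (h : L.State → ℝ) :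
    L.mean x (fun z s => L.qval μ 1 h z s - (g + h z)) =
      L.avgPower x + μ * L.mean x (fun z _ => L.queue z) - g := by
  simp only [mean_sub, mean_add, qval, one_mul, mean_const_mul]
  rw [mean_cont hx, mean_const hx, avgPower_eq_mean]
  simp only [queue]
  ring

lemma le_cost (hg : ∀ z, g + h z = L.bellman μ 1 h z) (hx : L.IsFrequency x) :
    g ≤ L.avgPower x + μ * L.mean x (fun z _ => L.queue z) := by
  have h1 := mean_qval_sub hx μ g h
  have h2 := mean_mono (c := fun _ _ => 0) (d := fun z s => L.qval μ 1 h z s - (g + h z)) hx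
    fun z s _ hs => by
      rw [hg, sub_nonneg]
      exact bellman_le z hs
  rw [mean_const hx] at h2
  linarith

lemma isOptRate_of_cost_le (hg : ∀ z, g + h z = L.bellman μ 1 h z) (hx : L.IsFrequency x)
    (hle : L.avgPower x + μ * L.mean x (fun z _ => L.queue z) ≤ g)
    (z : L.State) (s : Fin (L.S + 1)) (h0 : x z.1 z.2 s ≠ 0) : L.IsOptRate h z.2 z.1 s := by
  have h1 := mean_qval_sub hx μ g h
  have h2 := le_cost hg hx
  have h3 := eq_zero_of_mean_eq_zero hx (fun z s hs => by
    rw [hg, sub_nonneg]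
    exact bellman_le z hs) (h1.trans (by linarith)) z s h0
  have hf : L.Feasible z.1 s := by
    by_contra hf
    exact h0 (hx.feasible _ _ _ hf)
  refine isOptRate_of_qval_le (μ := μ) hf ?_
  rw [← hg]
  linarith

lemma cost_eq_of_isOptRate (hg : ∀ z, g + h z = L.bellman μ 1 h z) (hx : L.IsFrequency x)
    (hopt : ∀ (z : L.State) (s : Fin (L.S + 1)), x z.1 z.2 s ≠ 0 → L.IsOptRate h z.2 z.1 s) :
    L.avgPower x + μ * L.mean x (fun z _ => L.queue z) = g := by
  have h1 := mean_qval_sub hx μ g h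
  have h2 := mean_congr (c := fun z s => L.qval μ 1 h z s - (g + h z)) (d := fun _ _ => 0) hx
    fun z s h0 _ => by rw [hg, (hopt z s h0).qval_eq, sub_self]
  rw [mean_const hx] at h2
  linarith

lemma mixPolicy_cost {σ τ : ℕ → Fin (L.A + 1) → ℕ}
    {hσf : ∀ q ≤ L.Q, ∀ a, L.Feasible q (σ q a)} {hτf : ∀ q ≤ L.Q, ∀ a, L.Feasible q (τ q a)}
    {t : unitInterval} (hg : ∀ z, g + h z = L.bellman μ 1 h z)
    (hσ : ∀ q ≤ L.Q, ∀ a, L.IsOptRate h a q (σ q a))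
    (hτ : ∀ q ≤ L.Q, ∀ a, L.IsOptRate h a q (τ q a)) {π : L.State → ℝ}
    (hπ : (L.mixPolicy σ τ hσf hτf t).IsStationary π) :
    π ⬝ᵥ (L.mixPolicy σ τ hσf hτf t).slotPower + μ * (π ⬝ᵥ L.queue) = g := by
  rw [← avgPower_freq, ← mean_freq_state (L.mixPolicy σ τ hσf hτf t) π]
  refine cost_eq_of_isOptRate hg hπ.isFrequency fun z s h0 => ?_
  have h1 : (L.mixPolicy σ τ hσf hτf t).prob z.1 z.2 s ≠ 0 := right_ne_zero_of_mul h0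
  by_cases hs : (s : ℕ) = σ z.1 z.2
  · rw [hs]
    exact hσ _ (by omega) _
  · by_cases hs' : (s : ℕ) = τ z.1 z.2
    · rw [hs']
      exact hτ _ (by omega) _
    · simp [mixPolicy, hs, hs'] at h1

end Cost

/-! ### Intermediate values along mixtures -/

section Interpolation

variable {L : Link} {σ τ : ℕ → Fin (L.A + 1) → ℕ}
  {hσf : ∀ q ≤ L.Q, ∀ a, L.Feasible q (σ q a)} {hτf : ∀ q ≤ L.Q, ∀ a, L.Feasible q (τ q a)}

lemma mixPolicy_zero : L.mixPolicy σ τ hσf hτf 0 = L.rulePolicy σ hσf := by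
  simp [rulePolicy, mixPolicy]

lemma mixPolicy_one : L.mixPolicy σ τ hσf hτf 1 = L.rulePolicy τ hτf := by
  simp [rulePolicy, mixPolicy]

/-- A stationary law with a prescribed mean, from two laws whose means enclose it. -/
lemma Policy.exists_isStationary_eq {F : L.Policy} {π ν f : L.State → ℝ} {m : ℝ}
    (hπ : F.IsStationary π) (hν : F.IsStationary ν) (h1 : m ≤ π ⬝ᵥ f) (h2 : ν ⬝ᵥ f ≤ m) :
    ∃ ρ, F.IsStationary ρ ∧ ρ ⬝ᵥ f = m := by
  have hm : m ∈ segment ℝ (ν ⬝ᵥ f) (π ⬝ᵥ f) := by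
    rw [segment_eq_Icc (h2.trans h1)]
    exact ⟨h2, h1⟩
  obtain ⟨a, b, ha, hb, hab, e⟩ := hm
  refine ⟨a • ν + b • π, ⟨convex_stdSimplex ℝ L.State hν.1 hπ.1 ha hb hab, ?_⟩, ?_⟩
  · rw [Matrix.add_vecMul, Matrix.smul_vecMul, Matrix.smul_vecMul, hν.2, hπ.2]
  · rw [add_dotProduct, smul_dotProduct, smul_dotProduct]
    exact e

/-- The set is the projection of a compact set of pairs `(t, π)`; no continuous choice of a
stationary law is needed. -/
lemma isClosed_setOf_exists_stationary_ge (f : L.State → ℝ) (m : ℝ) :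
    IsClosed {t : unitInterval |
      ∃ π, (L.mixPolicy σ τ hσf hτf t).IsStationary π ∧ m ≤ π ⬝ᵥ f} := by
  have hcont : Continuous fun p : unitInterval × (L.State → ℝ) =>
      p.2 ᵥ* (L.mixPolicy σ τ hσf hτf p.1).trans := by
    refine continuous_pi fun y => ?_
    simp only [Matrix.vecMul, dotProduct, Policy.trans, Matrix.of_apply, mixPolicy]
    fun_prop
  have hdot : Continuous fun p : unitInterval × (L.State → ℝ) => p.2 ⬝ᵥ f := by fun_prop
  have hcpt : IsCompact ((Set.univ ×ˢ stdSimplex ℝ L.State) ∩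
      {p : unitInterval × (L.State → ℝ) |
        p.2 ᵥ* (L.mixPolicy σ τ hσf hτf p.1).trans = p.2 ∧ m ≤ p.2 ⬝ᵥ f}) := by
    refine (isCompact_univ.prod (isCompact_stdSimplex ℝ L.State)).inter_right ?_
    exact (isClosed_eq hcont continuous_snd).inter (isClosed_le continuous_const hdot)
  convert (hcpt.image continuous_fst).isClosed
  ext t
  constructor
  · rintro ⟨π, hπ, hm⟩
    exact ⟨(t, π), ⟨⟨trivial, hπ.1⟩, hπ.2, hm⟩, rfl⟩
  · rintro ⟨⟨t', π⟩, ⟨⟨-, h1⟩, h2, hm⟩, rfl⟩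
    exact ⟨π, ⟨h1, h2⟩, hm⟩

/-- An intermediate value theorem for means under stationary laws of mixtures. -/
lemma exists_mixPolicy_stationary_eq {f : L.State → ℝ} {m : ℝ}
    (h0 : ∃ π, (L.rulePolicy σ hσf).IsStationary π ∧ m ≤ π ⬝ᵥ f)
    (h1 : ∃ π, (L.rulePolicy τ hτf).IsStationary π ∧ π ⬝ᵥ f ≤ m) :
    ∃ t π, (L.mixPolicy σ τ hσf hτf t).IsStationary π ∧ π ⬝ᵥ f = m := by
  have hc1 := isClosed_setOf_exists_stationary_ge (hσf := hσf) (hτf := hτf) f m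
  have hc2 := isClosed_setOf_exists_stationary_ge (hσf := hσf) (hτf := hτf) (-f) (-m)
  simp only [dotProduct_neg, neg_le_neg_iff] at hc2
  -- The parameters with a law of mean at least `m` and those with a law of mean at most `m` are
  -- closed and cover `[0, 1]`, so they share some `t`. Convexity of its set of laws does the rest.
  obtain ⟨t, -, ⟨π, hπ, h3⟩, ⟨ν, hν, h4⟩⟩ := isPreconnected_closed_iff.1
    (isPreconnected_univ (α := unitInterval)) _ _ hc1 hc2 (fun t _ => by
      obtain ⟨π, hπ⟩ := (L.mixPolicy σ τ hσf hτf t).exists_isStationary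
      rcases le_total m (π ⬝ᵥ f) with h | h
      · exact Or.inl ⟨π, hπ, h⟩
      · exact Or.inr ⟨π, hπ, h⟩)
    ⟨0, trivial, by rw [← mixPolicy_zero (hτf := hτf)] at h0; exact h0⟩
    ⟨1, trivial, by rw [← mixPolicy_one (hσf := hσf)] at h1; exact h1⟩
  exact ⟨t, Policy.exists_isStationary_eq hπ hν h3 h4⟩

end Interpolation

/-! ### Threshold policies with a prescribed mean queue length -/

section Existence

variable {L : Link}

/-- Nothing is randomized, but a distinguished state must still be named. With zero arrivals, the
last queue length of rate `0` will do, as `0 < S`. -/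
lemma Regular.rulePolicy_isThreshold {σ : ℕ → Fin (L.A + 1) → ℕ} (hσ : L.Regular σ)
    (hf : ∀ q ≤ L.Q, ∀ a, L.Feasible q (σ q a)) :
    ∃ th sStar aStar, (L.rulePolicy σ hf).IsThreshold th sStar aStar := by
  have h0 : σ 0 0 = 0 := Nat.le_zero.1 (hf 0 (by omega) 0).2.1
  let q₀ := Nat.findGreatest (fun n => σ n 0 = 0) L.Q
  have hq₀ : σ q₀ 0 = 0 := Nat.findGreatest_spec (P := fun n => σ n 0 = 0) (Nat.zero_le _) h0
  have hq₀Q : q₀ ≤ L.Q := Nat.findGreatest_le _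
  have hS : 0 < L.S := L.A_pos.trans_le L.A_le_S
  have hprob : ∀ (q : Fin (L.Q + 1)) a (s : Fin (L.S + 1)), (L.rulePolicy σ hf).prob q a s =
      if (s : ℕ) = σ q a then 1 else 0 := by
    intro q a s
    simp [rulePolicy, mixPolicy]
  refine ⟨_, _, _, hσ.isThreshold hf (q₀ := ⟨q₀, by omega⟩) (a₀ := 0) (fun q h1 h2 => ?_)
    (by simpa [hq₀] using hS) (fun q a s _ => hprob q a s) (fun s h1 _ => ?_)⟩
  · have := Nat.findGreatest_is_greatest (P := fun n => σ n 0 = 0) h1 h2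
    simp only [hq₀]
    omega
  · rw [hprob, if_neg h1]

/-- Regularity of the raised rule forces larger rates after `q₀`, so `q₀` is the last queue length
with its rate, which is where a threshold policy may randomize. -/
lemma Regular.mixPolicy_bump_isThreshold {σ : ℕ → Fin (L.A + 1) → ℕ} (hσ : L.Regular σ)
    {q₀ : ℕ} (hq₀ : q₀ ≤ L.Q) {a₀ : Fin (L.A + 1)} (hb : L.Regular (bump σ q₀ a₀))
    (hf : ∀ q ≤ L.Q, ∀ a, L.Feasible q (σ q a))
    (hbf : ∀ q ≤ L.Q, ∀ a, L.Feasible q (bump σ q₀ a₀ q a)) (t : unitInterval) :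
    ∃ th sStar aStar, (L.mixPolicy σ (bump σ q₀ a₀) hf hbf t).IsThreshold th sStar aStar := by
  have hb0 : bump σ q₀ a₀ q₀ a₀ = σ q₀ a₀ + 1 := by simp [bump]
  refine ⟨_, _, _, hσ.isThreshold hf (q₀ := ⟨q₀, by omega⟩) (a₀ := a₀) (fun q h1 h2 => ?_)
    ?_ (fun q a s hne => ?_) (fun s h1 h2 => ?_)⟩
  · have h3 := (hb.mono a₀ (q := q₀) (q' := q) (le_of_lt h1) h2).1
    have h1' : q ≠ q₀ := (ne_of_lt h1).symm
    rw [hb0] at h3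
    simp only [bump, h1', false_and, if_false] at h3
    simp only
    omega
  · have := (hbf q₀ hq₀ a₀).2.2
    rw [hb0] at this
    simp only
    omega
  · have hne' : ¬ ((q : ℕ) = q₀ ∧ a = a₀) := fun h => hne ⟨Fin.ext h.1, h.2⟩
    simp only [mixPolicy, bump, hne', if_false]
    ring
  · simp only at h1 h2
    simp only [mixPolicy, hb0, if_neg h1, if_neg h2]
    ring

/-- The mean queue length of optimal state-action frequencies is attained by a threshold policy
that is a mixture of two regular rate functions with optimal rates. -/
lemma exists_threshold_mixPolicy {h : L.State → ℝ} (hh : L.QueueConvex h)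
    {x : Fin (L.Q + 1) → Fin (L.A + 1) → Fin (L.S + 1) → ℝ} (hx : L.IsFrequency x)
    (hopt : ∀ (z : L.State) (s : Fin (L.S + 1)), x z.1 z.2 s ≠ 0 → L.IsOptRate h z.2 z.1 s) :
    ∃ (σ τ : ℕ → Fin (L.A + 1) → ℕ) (hσf : ∀ q ≤ L.Q, ∀ a, L.Feasible q (σ q a))
      (hτf : ∀ q ≤ L.Q, ∀ a, L.Feasible q (τ q a)) (t : unitInterval),
      L.Regular σ ∧ L.Regular τ ∧ (∀ q ≤ L.Q, ∀ a, L.IsOptRate h a q (σ q a)) ∧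
      (∀ q ≤ L.Q, ∀ a, L.IsOptRate h a q (τ q a)) ∧
      (∃ th sStar aStar, (L.mixPolicy σ τ hσf hτf t).IsThreshold th sStar aStar) ∧
      ∃ π, (L.mixPolicy σ τ hσf hτf t).IsStationary π ∧
        π ⬝ᵥ L.queue = L.mean x (fun z _ => L.queue z) := by
  classical
  obtain ⟨lo, hi, hlo, hhi, hint⟩ := exists_optRate_interval hh
  set m := L.mean x (fun z _ => L.queue z)
  have hlohi : ∀ q ≤ L.Q, ∀ a, lo q a ≤ hi q a := by
    intro q hq a
    obtain ⟨s, hs⟩ := exists_isOptRate h a hq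
    have := (hint q hq a s).1 hs
    omega
  -- `n` is the distance from `σ` to `hi`. Among the regular optimal rules with a law of mean at
  -- least `m`, the one closest to `hi` is taken, starting from `lo`.
  let Cand : ℕ → Prop := fun n => ∃ (σ : ℕ → Fin (L.A + 1) → ℕ)
    (hσ : ∀ q ≤ L.Q, ∀ a, L.IsOptRate h a q (σ q a)), L.Regular σ ∧
    n = ∑ q ∈ Finset.range (L.Q + 1), ∑ a, (hi q a - σ q a) ∧
    ∃ π, (L.rulePolicy σ fun q hq a => (hσ q hq a).1).IsStationary π ∧ m ≤ π ⬝ᵥ L.queue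
  have hex : ∃ n, Cand n := by
    have hloo : ∀ q ≤ L.Q, ∀ a, L.IsOptRate h a q (lo q a) :=
      fun q hq a => (hint q hq a _).2 ⟨le_rfl, hlohi q hq a⟩
    exact ⟨_, lo, hloo, hlo, rfl, exists_stationary_queue_ge hx hlo _
      fun z s h0 => ((hint z.1 (by omega) z.2 s).1 (hopt z s h0)).1⟩
  obtain ⟨σ, hσo, hσ, hn, π, hπ, hπm⟩ := Nat.find_spec hex
  have hmin := fun n hn => Nat.find_min hex (m := n) hn
  rw [hn] at hmin
  have hσf : ∀ q ≤ L.Q, ∀ a, L.Feasible q (σ q a) := fun q hq a => (hσo q hq a).1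
  by_cases hlow : ∃ ν, (L.rulePolicy σ hσf).IsStationary ν ∧ ν ⬝ᵥ L.queue ≤ m
  · obtain ⟨ν, hν, hνm⟩ := hlow
    exact ⟨σ, σ, hσf, hσf, 0, hσ, hσ, hσo, hσo, hσ.rulePolicy_isThreshold hσf,
      Policy.exists_isStationary_eq hπ hν hπm hνm⟩
  · have hlt : ∃ q ≤ L.Q, ∃ a, σ q a < hi q a := by
      by_contra! hge
      refine hlow (exists_stationary_queue_le hx hσ hσf fun z s h0 => ?_)
      exact ((hint z.1 (by omega) z.2 s).1 (hopt z s h0)).2.trans (hge z.1 (by omega) z.2)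
    obtain ⟨q, hq, a, hqa⟩ := hlt
    obtain ⟨q₀, hq₀, hlt₀, hb⟩ := hσ.exists_bump hhi hq hqa
    have hbo : ∀ q ≤ L.Q, ∀ b, L.IsOptRate h b q (bump σ q₀ a q b) := by
      intro q hq b
      by_cases hqb : q = q₀ ∧ b = a
      · obtain ⟨rfl, rfl⟩ := hqb
        refine (hint _ hq _ _).2 ?_
        have := ((hint _ hq b _).1 (hσo _ hq b)).1
        simp only [bump, and_self, if_true]
        omega
      · simp only [bump, hqb, if_false]
        exact hσo q hq b
    have hbf : ∀ q ≤ L.Q, ∀ b, L.Feasible q (bump σ q₀ a q b) := fun q hq b => (hbo q hq b).1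
    -- The raised rule is closer to `hi`, so by minimality all its laws have mean below `m`: the
    -- crossing occurs between `σ` and this neighbour.
    have hnb : ¬ ∃ ν, (L.rulePolicy (bump σ q₀ a) hbf).IsStationary ν ∧ m ≤ ν ⬝ᵥ L.queue := by
      intro hν
      refine hmin _ ?_ ⟨bump σ q₀ a, hbo, hb, rfl, hν⟩
      have hle : ∀ q b, hi q b - bump σ q₀ a q b ≤ hi q b - σ q b := by
        intro q b
        simp only [bump]
        split_ifs <;> omega
      refine Finset.sum_lt_sum (fun q _ => Finset.sum_le_sum fun b _ => hle q b)
        ⟨q₀, Finset.mem_range.2 (by omega), Finset.sum_lt_sum (fun b _ => hle q₀ b)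
          ⟨a, Finset.mem_univ _, ?_⟩⟩
      simp only [bump, and_self, if_true]
      omega
    obtain ⟨ν, hν⟩ := (L.rulePolicy (bump σ q₀ a) hbf).exists_isStationary
    have hνm : ν ⬝ᵥ L.queue ≤ m := by
      by_contra! h'
      exact hnb ⟨ν, hν, h'.le⟩
    obtain ⟨t, ρ, hρ⟩ := exists_mixPolicy_stationary_eq (hσf := hσf) (hτf := hbf)
      ⟨π, hπ, hπm⟩ ⟨ν, hν, hνm⟩
    exact ⟨σ, bump σ q₀ a, hσf, hbf, t, hσ, hb, hσo, hbo,
      hσ.mixPolicy_bump_isThreshold hq₀ hb hσf hbf t, ρ, hρ⟩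

end Existence

/-! ### Weighted sums of power and delay -/

section Weighted

variable {L : Link}

/-- `r` minimizes power plus `lam` times delay. -/
def Minimizes (L : Link) (lam : ℝ) (r : ℝ × ℝ) : Prop :=
  r ∈ L.obtainable ∧ ∀ r' ∈ L.obtainable, r.1 + lam * r.2 ≤ r'.1 + lam * r'.2

lemma mean_queue_eq (x : Fin (L.Q + 1) → Fin (L.A + 1) → Fin (L.S + 1) → ℝ) :
    L.mean x (fun z _ => L.queue z) = L.α * L.avgDelay x := by
  have := L.α_pos.ne'
  rw [avgDelay_eq_mean]
  field_simp
  rfl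

lemma freq_mem_obtainable {F : L.Policy} {π : L.State → ℝ} (hπ : F.IsStationary π) :
    (π ⬝ᵥ F.slotPower, (1 / L.α) * (π ⬝ᵥ L.queue)) ∈ L.obtainable := by
  rw [← avgPower_freq, ← avgDelay_freq]
  exact hπ.isFrequency.mem_obtainable

/-- Minimizers of the weighted sum are attained by threshold policies; for a positive weight on
the delay, all stationary laws of the policy attain them. -/
lemma Minimizes.exists_threshold {lam : ℝ} (hlam : 0 ≤ lam) {p : ℝ × ℝ} (hp : L.Minimizes lam p) :
    ∃ F : L.Policy, (∃ th sStar aStar, F.IsThreshold th sStar aStar) ∧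
      (∃ π, F.IsStationary π ∧ L.avgPower (F.freq π) = p.1 ∧ L.avgDelay (F.freq π) = p.2) ∧
      (0 < lam → ∀ π, F.IsStationary π →
        π ⬝ᵥ F.slotPower = p.1 ∧ π ⬝ᵥ L.queue = L.α * p.2) := by
  have hα := L.α_pos
  obtain ⟨⟨x, hx, rfl⟩, hmin⟩ := hp
  obtain ⟨g, h, hh, hg⟩ := L.exists_averageCost (μ := lam / L.α) (by positivity)
  have hμ : ∀ y : ℝ, lam / L.α * (L.α * y) = lam * y := fun y => by field_simp
  -- The rule `lo` has cost exactly `g`, so the minimizer costs no more and uses optimal rates only.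
  have hle : L.avgPower x + lam / L.α * L.mean x (fun z _ => L.queue z) ≤ g := by
    obtain ⟨lo, hi, -, -, hint⟩ := exists_optRate_interval hh
    have hlo : ∀ q ≤ L.Q, ∀ a, L.IsOptRate h a q (lo q a) := by
      intro q hq a
      obtain ⟨s, hs⟩ := exists_isOptRate h a hq
      have := (hint q hq a s).1 hs
      exact (hint q hq a _).2 ⟨le_rfl, by omega⟩
    obtain ⟨π, hπ⟩ := (L.rulePolicy lo fun q hq a => (hlo q hq a).1).exists_isStationary
    have h1 := mixPolicy_cost hg hlo hlo hπ
    have h2 := hmin _ (freq_mem_obtainable hπ)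
    rw [mean_queue_eq, hμ, ← h1]
    refine h2.trans (le_of_eq ?_)
    ring
  have hopt := isOptRate_of_cost_le hg hx hle
  have hxg := cost_eq_of_isOptRate hg hx hopt
  obtain ⟨σ, τ, hσf, hτf, t, hσ, hτ, hσo, hτo, hth, π, hπ, hπq⟩ :=
    exists_threshold_mixPolicy hh hx hopt
  have hπg := mixPolicy_cost hg hσo hτo hπ
  have hπP : π ⬝ᵥ (L.mixPolicy σ τ hσf hτf t).slotPower = L.avgPower x := by
    rw [hπq] at hπg
    linarith
  rw [mean_queue_eq] at hπq
  refine ⟨_, hth, ⟨π, hπ, ?_, ?_⟩, fun hpos ν hν => ?_⟩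
  · rw [avgPower_freq, hπP]
  · rw [avgDelay_freq, hπq]
    field_simp
  · have hνP := mixPolicy_power_unique hσ hτ hν hπ
    have hνg := mixPolicy_cost hg hσo hτo hν
    refine ⟨hνP.trans hπP, ?_⟩
    have h1 : lam / L.α * (ν ⬝ᵥ L.queue) = lam / L.α * (π ⬝ᵥ L.queue) := by linarith
    rw [mul_right_inj' (by positivity)] at h1
    rw [h1, hπq]

/-- Finitely many obtainable pairs contain a minimizer for every weight. -/
lemma exists_finite_minimizers (L : Link) :
    ∃ R : Set (ℝ × ℝ), R.Finite ∧ ∀ lam : ℝ, 0 ≤ lam → ∃ r ∈ R, L.Minimizes lam r := by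
  -- One stationary law is fixed for each policy. For every weight, any deterministic selection of
  -- optimal rates is optimal, and there are finitely many deterministic policies.
  choose law hlaw using fun F : L.Policy => F.exists_isStationary
  have hfin : {F : L.Policy | ∀ q a s, F.prob q a s ∈ ({0, 1} : Set ℝ)}.Finite := by
    have h1 : {f : Fin (L.Q + 1) → Fin (L.A + 1) → Fin (L.S + 1) → ℝ |
        ∀ q, f q ∈ {f' : Fin (L.A + 1) → Fin (L.S + 1) → ℝ |
          ∀ a, f' a ∈ {f'' : Fin (L.S + 1) → ℝ | ∀ s, f'' s ∈ ({0, 1} : Set ℝ)}}}.Finite :=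
      Set.Finite.pi' fun _ => Set.Finite.pi' fun _ => Set.Finite.pi' fun _ =>
        Set.toFinite ({0, 1} : Set ℝ)
    refine h1.preimage (f := Policy.prob) (Function.Injective.injOn fun F G h => ?_)
    cases F
    cases G
    simpa using h
  refine ⟨_, hfin.image fun F => (law F ⬝ᵥ F.slotPower, (1 / L.α) * (law F ⬝ᵥ L.queue)), ?_⟩
  intro lam hlam
  have hα := L.α_pos
  obtain ⟨g, h, hh, hg⟩ := L.exists_averageCost (μ := lam / L.α) (by positivity)
  choose s hs using fun (z : L.State) => exists_isOptRate h z.2 (Nat.lt_succ_iff.1 z.1.2)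
  have hso : ∀ q ≤ L.Q, ∀ a, L.IsOptRate h a q (s (L.idx q, a)) := by
    intro q hq a
    have := hs (L.idx q, a)
    rwa [idx_val hq] at this
  let F := L.rulePolicy (fun q a => s (L.idx q, a)) fun q hq a => (hso q hq a).1
  refine ⟨_, ⟨F, ?_, rfl⟩, freq_mem_obtainable (hlaw F), ?_⟩
  · intro q a r
    simp only [F, mixPolicy]
    split_ifs <;> simp
  · rintro _ ⟨x, hx, rfl⟩
    have h1 := le_cost hg hx
    have h2 := mixPolicy_cost hg hso hso (hlaw F)
    rw [mean_queue_eq] at h1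
    have h3 : lam / L.α * (L.α * L.avgDelay x) = lam * L.avgDelay x := by field_simp
    have h4 : lam * ((1 / L.α) * (law F ⬝ᵥ L.queue)) = lam / L.α * (law F ⬝ᵥ L.queue) := by ring
    simp only
    rw [h4]
    linarith

/-- By pigeonhole, one pair serves infinitely many weights of the sequence, so the weights can go to
a limit while the pair stays fixed. -/
lemma exists_frequently_minimizes (L : Link) {lam : ℕ → ℝ} (hlam : ∀ n, 0 ≤ lam n) :
    ∃ r, ∀ N, ∃ n ≥ N, L.Minimizes (lam n) r := by
  obtain ⟨R, hR, hmin⟩ := L.exists_finite_minimizers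
  choose r hrR hr using fun n => hmin (lam n) (hlam n)
  have : Finite R := hR
  obtain ⟨r', hr'⟩ := Finite.exists_infinite_fiber fun n => (⟨r n, hrR n⟩ : R)
  refine ⟨r', fun N => ?_⟩
  obtain ⟨n, hn, hN⟩ := (Set.infinite_coe_iff.1 hr').exists_gt N
  refine ⟨n, hN.le, ?_⟩
  rw [← show r n = r' from congrArg Subtype.val hn]
  exact hr n

/-- The delay-optimal pair of least power minimizes a weighted sum with positive weights. -/
lemma IsDelayOptimal.exists_pos_minimizes {p : ℝ × ℝ} (hp : L.IsDelayOptimal p)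
    (hmin : ∀ r ∈ L.obtainable, p.1 ≤ r.1) : ∃ lam, 0 < lam ∧ L.Minimizes lam p := by
  obtain ⟨r, hr⟩ := L.exists_frequently_minimizes (lam := fun n => 1 / ((n : ℝ) + 1))
    fun n => by positivity
  have hrO : r ∈ L.obtainable := by
    obtain ⟨n, -, hn⟩ := hr 0
    exact hn.1
  have h1 := hmin r hrO
  -- A positive excess `r.1 - p.1` could be offset by delay only up to a fixed amount, while the
  -- weight of the delay tends to zero.
  have h2 : r.1 = p.1 := by
    refine le_antisymm ?_ h1
    by_contra! hlt
    obtain ⟨N, hN⟩ := exists_nat_gt ((p.2 - r.2) / (r.1 - p.1))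
    rw [div_lt_iff₀ (sub_pos.2 hlt)] at hN
    obtain ⟨n, hn, hrn⟩ := hr N
    have h3 := hrn.2 p hp.1
    have hn' : (N : ℝ) ≤ n := by exact_mod_cast hn
    have hn0 : (0 : ℝ) < (n : ℝ) + 1 := by positivity
    have h4 : (n + 1 : ℝ) * (r.1 + 1 / ((n : ℝ) + 1) * r.2) ≤
        (n + 1) * (p.1 + 1 / ((n : ℝ) + 1) * p.2) := mul_le_mul_of_nonneg_left h3 hn0.le
    have h5 : ∀ y z : ℝ, (n + 1 : ℝ) * (y + 1 / ((n : ℝ) + 1) * z) = (n + 1) * y + z := by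
      intro y z
      field_simp
    rw [h5, h5] at h4
    nlinarith
  have h3 := hp.2 r hrO h2.le
  obtain ⟨n, -, hn⟩ := hr 0
  have hpos : (0 : ℝ) < 1 / ((n : ℝ) + 1) := by positivity
  have h4 := hn.2 p hp.1
  rw [h2] at h4
  have h5 : r.2 ≤ p.2 := le_of_mul_le_mul_left (by linarith) hpos
  have : r = p := Prod.ext h2 (le_antisymm h5 h3)
  exact ⟨_, hpos, this ▸ hn⟩

/-- The pair of least delay, if it is unique, minimizes a weighted sum with positive weights. -/
lemma exists_pos_minimizes_of_min_delay {p : ℝ × ℝ} (hp : p ∈ L.obtainable)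
    (hmin : ∀ r ∈ L.obtainable, p.2 ≤ r.2) (huniq : ∀ r ∈ L.obtainable, r.2 = p.2 → r.1 = p.1) :
    ∃ lam, 0 < lam ∧ L.Minimizes lam p := by
  obtain ⟨r, hr⟩ := L.exists_frequently_minimizes (lam := fun n => (n : ℝ) + 1)
    fun n => by positivity
  obtain ⟨n, -, hn⟩ := hr 0
  have h2 : r.2 = p.2 := by
    refine le_antisymm ?_ (hmin r hn.1)
    by_contra! hlt
    obtain ⟨N, hN⟩ := exists_nat_gt ((p.1 - r.1) / (r.2 - p.2))
    rw [div_lt_iff₀ (sub_pos.2 hlt)] at hN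
    obtain ⟨k, hk, hrk⟩ := hr N
    have h3 := hrk.2 p hp
    have hk' : (N : ℝ) ≤ k := by exact_mod_cast hk
    nlinarith
  have : r = p := Prod.ext (huniq r hn.1 h2) h2
  exact ⟨(n : ℝ) + 1, by positivity, this ▸ hn⟩

end Weighted

/-! ### Pairs of least delay -/

section MinDelay

variable {L : Link} {x : Fin (L.Q + 1) → Fin (L.A + 1) → Fin (L.S + 1) → ℝ}

/-- The number of packets left in the queue after the transmission. -/
def backlog (L : Link) (z : L.State) (s : ℕ) : ℝ := L.queue z - s

/-- The next queue consists of the remainder and the new arrivals, whose mean no policy can change;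
minimizing delay is minimizing the mean remainder. -/
lemma mean_queue_eq_backlog (hx : L.IsFrequency x) :
    L.mean x (fun z _ => L.queue z) = L.mean x L.backlog + ∑ a, L.φ a * L.nextArrival a := by
  rw [← mean_cont hx, ← hx.mean_arrival, ← mean_add]
  refine mean_congr hx fun z s _ hs => ?_
  rw [cont_queue hs, backlog, queue]

lemma backlog_nonneg {z : L.State} {s : ℕ} (hs : L.Feasible z.1 s) : 0 ≤ L.backlog z s := by
  have : (s : ℝ) ≤ ((z.1 : ℕ) : ℝ) := by exact_mod_cast hs.2.1
  simpa [backlog, queue] using this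

/-- Transmitting as much as possible leaves no packets in the queue. -/
lemma exists_backlog_eq_zero (L : Link) :
    ∃ x, L.IsFrequency x ∧ L.mean x L.backlog ≤ 0 := by
  have hf : ∀ q ≤ L.Q, ∀ _ : Fin (L.A + 1), L.Feasible q (min q L.S) :=
    fun q hq _ => feasible_min hq
  set F := L.rulePolicy (fun q _ => min q L.S) hf with hF
  let f : L.State → ℝ := fun z => -L.backlog z (min (z.1 : ℕ) L.S)
  -- A queue of length at most `S` is emptied completely, and the next one consists of at most `A ≤
  -- S` new arrivals.
  have hzero : ∀ n (z : L.State), (z.1 : ℕ) ≤ L.S → (F.trans ^ n *ᵥ f) z = 0 := by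
    intro n
    induction n with
    | zero =>
      intro z hz
      have : min (z.1 : ℕ) L.S = z.1 := min_eq_left hz
      simp only [pow_zero, Matrix.one_mulVec, f, backlog, queue, this, sub_self, neg_zero]
    | succ n ih =>
      intro z hz
      rw [pow_succ', ← Matrix.mulVec_mulVec, hF, rulePolicy_trans_mulVec, min_eq_left hz,
        Nat.sub_self]
      refine Finset.sum_eq_zero fun a' _ => ?_
      have h1 := L.A_le_S
      have h2 := L.A_le_Q
      rw [ih, mul_zero]
      rw [idx_val (by omega)]
      omega
  obtain ⟨π, h1, h2, h3⟩ := Markov.exists_stationary_ge F.trans_mem_rowStochastic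
    (single_mem_stdSimplex ℝ ((0, 0) : L.State)) (f := f) (m := 0) (fun n => by
      simp [hzero n (0, 0) (by simp)])
  have hπ : F.IsStationary π := ⟨h1, h2⟩
  refine ⟨F.freq π, hπ.isFrequency, ?_⟩
  have h4 : (fun z : L.State => ∑ s : Fin (L.S + 1), F.prob z.1 z.2 s * L.backlog z s) = -f := by
    funext z
    rw [hF, sum_mixPolicy_mul hf hf 0 z (L.backlog z)]
    simp [f]
  rw [mean_freq, h4, dotProduct_neg]
  linarith

/-- The power of obtainable pairs with the least delay is unique. -/
lemma power_unique_of_min_delay {p r : ℝ × ℝ} (hp : p ∈ L.obtainable)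
    (hmin : ∀ r ∈ L.obtainable, p.2 ≤ r.2) (hr : r ∈ L.obtainable) (hrp : r.2 = p.2) :
    r.1 = p.1 := by
  obtain ⟨x₀, hx₀, hb₀⟩ := L.exists_backlog_eq_zero
  have hα := L.α_pos
  -- At least delay the remainder is almost surely zero, so each slot transmits exactly its arrivals
  -- and the power is determined by `φ` and `γ`.
  have key : ∀ {x}, L.IsFrequency x → L.avgDelay x = p.2 → L.avgPower x =
      ∑ a, L.φ a * L.cont (fun z => L.P z.1) a 0 := by
    intro x hx hxp
    have h1 := hmin _ hx₀.mem_obtainable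
    have h2 := mean_queue_eq_backlog hx
    have h3 := mean_queue_eq_backlog hx₀
    rw [mean_queue_eq] at h2 h3
    have h4 : L.α * L.avgDelay x ≤ L.α * L.avgDelay x₀ :=
      mul_le_mul_of_nonneg_left (hxp ▸ h1) hα.le
    have h5 : 0 ≤ L.mean x L.backlog := by
      rw [← mean_const hx 0]
      exact mean_mono hx fun z s _ hs => backlog_nonneg hs
    have h6 : L.mean x L.backlog = 0 := by linarith
    have h7 : ∀ (z : L.State) (s : Fin (L.S + 1)), x z.1 z.2 s ≠ 0 → (z.1 : ℕ) = s := by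
      intro z s h0
      have := eq_zero_of_mean_eq_zero hx (fun z s hs => backlog_nonneg hs) h6 z s h0
      simp only [backlog, queue, sub_eq_zero] at this
      exact_mod_cast this
    rw [avgPower_eq_mean, ← hx.mean_arrival]
    calc L.mean x (fun _ s => L.P s) = L.mean x (fun z _ => L.P z.1) :=
          mean_congr hx fun z s h0 _ => by rw [h7 z s h0]
      _ = L.mean x (fun z s => L.cont (fun z => L.P z.1) z.2 (z.1 - s)) := (mean_cont hx _).symm
      _ = _ := mean_congr hx fun z s h0 _ => by rw [h7 z s h0, Nat.sub_self]
  obtain ⟨x, hx, rfl⟩ := hp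
  obtain ⟨y, hy, rfl⟩ := hr
  exact (key hy hrp).trans (key hx rfl).symm

end MinDelay

/-! ### Supporting lines of the obtainable set -/

section Scalarization

variable {L : Link}

lemma convex_obtainable (L : Link) : Convex ℝ L.obtainable := by
  rintro _ ⟨x, hx, rfl⟩ _ ⟨y, hy, rfl⟩ a b ha hb hab
  have hmean : ∀ c, L.mean (fun q i s => a * x q i s + b * y q i s) c =
      a * L.mean x c + b * L.mean y c := by
    intro c
    simp only [mean, add_mul, Finset.sum_add_distrib, Finset.mul_sum, mul_assoc]
  refine ⟨fun q i s => a * x q i s + b * y q i s, ⟨fun q i s => ?_, ?_, fun q i s hs => ?_,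
    fun q' a' => ?_⟩, ?_⟩
  · exact add_nonneg (mul_nonneg ha (hx.nonneg _ _ _)) (mul_nonneg hb (hy.nonneg _ _ _))
  · simp only [Finset.sum_add_distrib, ← Finset.mul_sum, hx.sum_eq_one, hy.sum_eq_one, mul_one,
      hab]
  · rw [hx.feasible q i s hs, hy.feasible q i s hs]
    simp
  · rw [Finset.sum_add_distrib, ← Finset.mul_sum, ← Finset.mul_sum, ← hx.balance, ← hy.balance]
    simp only [Finset.mul_sum, ← Finset.sum_add_distrib]
    refine Finset.sum_congr rfl fun q _ => Finset.sum_congr rfl fun i _ =>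
      Finset.sum_congr rfl fun s _ => ?_
    ring
  · ext
    · simp only [avgPower_eq_mean, hmean]
      rfl
    · simp only [avgDelay_eq_mean, hmean, Prod.snd_add, Prod.smul_snd, smul_eq_mul]
      ring

/-- Points of the tradeoff curve minimize a weighted sum of power and delay. -/
lemma exists_weights {p : ℝ × ℝ} (hp : p ∈ L.tradeoffCurve) :
    ∃ v w : ℝ, 0 ≤ v ∧ 0 ≤ w ∧ (v ≠ 0 ∨ w ≠ 0) ∧
      ∀ r ∈ L.obtainable, v * p.1 + w * p.2 ≤ v * r.1 + w * r.2 := by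
  -- Separate the obtainable pairs from the open quadrant of pairs strictly better than `p` in both
  -- coordinates.
  obtain ⟨f, u, h1, h2⟩ := geometric_hahn_banach_open
    (s := Set.Iio p.1 ×ˢ Set.Iio p.2) (t := L.obtainable)
    ((convex_Iio _).prod (convex_Iio _)) (isOpen_Iio.prod isOpen_Iio) L.convex_obtainable (by
      rw [Set.disjoint_left]
      rintro r ⟨hr1, hr2⟩ hr
      rcases hp.2 r hr with h | h
      · exact absurd h (not_le.2 hr1)
      · exact absurd h (not_le.2 hr2))
  have hf : ∀ r : ℝ × ℝ, f r = f (1, 0) * r.1 + f (0, 1) * r.2 := by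
    intro r
    have : r = r.1 • ((1 : ℝ), (0 : ℝ)) + r.2 • ((0 : ℝ), (1 : ℝ)) := by ext <;> simp
    conv_lhs => rw [this, map_add, map_smul, map_smul]
    simp only [smul_eq_mul]
    ring
  set v := f (1, 0)
  set w := f (0, 1)
  have hlt : ∀ a b : ℝ, 0 < a → 0 < b → 0 < v * a + w * b := by
    intro a b ha hb
    have h3 := h1 (p.1 - a, p.2 - b) ⟨by simpa using ha, by simpa using hb⟩
    have h4 := h2 p hp.1
    rw [hf] at h3 h4
    simp only at h3
    linarith
  -- `p` is the corner of the quadrant, hence in its closure; otherwise a diagonal step of suitable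
  -- length would land on the level `u`.
  have hle : f p ≤ u := by
    by_contra! h
    have h11 := hlt 1 1 one_pos one_pos
    simp only [mul_one] at h11
    have he : 0 < (f p - u) / (v + w) := div_pos (by linarith) h11
    have h3 := h1 (p.1 - (f p - u) / (v + w), p.2 - (f p - u) / (v + w))
      ⟨by simpa using he, by simpa using he⟩
    have h4 : (v + w) * ((f p - u) / (v + w)) = f p - u := mul_div_cancel₀ _ h11.ne'
    rw [hf] at h3
    have h5 := hf p
    simp only at h3
    linarith
  refine ⟨v, w, ?_, ?_, ?_, fun r hr => ?_⟩
  · by_contra! hv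
    have h3 := hlt ((|w| + 1) / (-v)) 1 (div_pos (by positivity) (by linarith)) one_pos
    have h4 : v * ((|w| + 1) / (-v)) = -(|w| + 1) := by
      have := hv.ne
      field_simp
    have := le_abs_self w
    linarith
  · by_contra! hw
    have h3 := hlt 1 ((|v| + 1) / (-w)) one_pos (div_pos (by positivity) (by linarith))
    have h4 : w * ((|v| + 1) / (-w)) = -(|v| + 1) := by
      have := hw.ne
      field_simp
    have := le_abs_self v
    linarith
  · by_contra! h
    have h3 := hlt 1 1 one_pos one_pos
    rw [h.1, h.2] at h3
    simp at h3
  · rw [← hf, ← hf]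
    exact hle.trans (h2 r hr)

/-- Points of the tradeoff curve minimize power plus a multiple of the delay, with a positive
multiple if they are delay-optimal. -/
lemma exists_minimizes {p : ℝ × ℝ} (hp : p ∈ L.tradeoffCurve) :
    ∃ lam, 0 ≤ lam ∧ L.Minimizes lam p ∧ (L.IsDelayOptimal p → 0 < lam) := by
  obtain ⟨v, w, hv, hw, hvw, hmin⟩ := exists_weights hp
  -- With `v = 0` the pair has least delay; with `w = 0` it has least power. A supporting line with
  -- both weights positive must then be found by other means.
  rcases hv.eq_or_lt with rfl | hv
  · have hw' : 0 < w := lt_of_le_of_ne hw (by simpa [eq_comm] using hvw)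
    have hd : ∀ r ∈ L.obtainable, p.2 ≤ r.2 := fun r hr =>
      le_of_mul_le_mul_left (by simpa using hmin r hr) hw'
    obtain ⟨lam, hlam, h⟩ := exists_pos_minimizes_of_min_delay hp.1 hd
      fun r hr h => power_unique_of_min_delay hp.1 hd hr h
    exact ⟨lam, hlam.le, h, fun _ => hlam⟩
  · have hm : L.Minimizes (w / v) p := by
      refine ⟨hp.1, fun r hr => le_of_mul_le_mul_left ?_ hv⟩
      have h1 : ∀ y z : ℝ, v * (y + w / v * z) = v * y + w * z := by
        intro y z
        field_simp
      rw [h1, h1]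
      exact hmin r hr
    rcases hw.eq_or_lt with rfl | hw
    · by_cases hopt : L.IsDelayOptimal p
      · obtain ⟨lam, hlam, h⟩ := hopt.exists_pos_minimizes fun r hr => by
          simpa using hm.2 r hr
        exact ⟨lam, hlam.le, h, fun _ => hlam⟩
      · exact ⟨_, by simp, hm, fun h => absurd h hopt⟩
    · exact ⟨_, (div_pos hw hv).le, hm, fun _ => div_pos hw hv⟩

end Scalarization

/-! ### Long-run averages of arbitrary policies -/

section Averages

variable {L : Link} {F : L.Policy} {z : L.State}

lemma Policy.hasDelay_iff {d : ℝ} : F.HasDelay z d ↔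
    Tendsto (fun N : ℕ => (1 / (N : ℝ)) * ∑ n ∈ Finset.Icc 1 N, (F.trans ^ n *ᵥ L.queue) z)
      atTop (𝓝 (L.α * d)) := by
  have hα := L.α_pos.ne'
  have h : ∀ N : ℕ, (1 / (N : ℝ)) * ∑ n ∈ Finset.Icc 1 N, (F.trans ^ n *ᵥ L.queue) z =
      L.α * ((1 / (N : ℝ)) * ((1 / L.α) * ∑ n ∈ Finset.Icc 1 N, (F.trans ^ n *ᵥ L.queue) z)) := by
    intro N
    field_simp
  simp_rw [h]
  refine ⟨fun h => h.const_mul L.α, fun h => ?_⟩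
  have h' := h.const_mul L.α⁻¹
  simp only [inv_mul_cancel_left₀ hα] at h'
  exact h'

/-- Both limits are means under one and the same stationary law, a cluster point of the average
laws; its frequencies witness membership. -/
lemma Policy.mem_obtainable {P' D' : ℝ} (hP : F.HasPower z P') (hD : F.HasDelay z D') :
    (P', D') ∈ L.obtainable := by
  have hα := L.α_pos.ne'
  obtain ⟨π, h1, h2, h3, h4⟩ := Markov.exists_stationary_of_tendsto_average
    F.trans_mem_rowStochastic hP (Policy.hasDelay_iff.1 hD)
  have := freq_mem_obtainable (F := F) (π := π) ⟨h1, h2⟩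
  rw [h3, h4] at this
  convert this using 2
  field_simp

end Averages

end Link

end

theorem theorem6 (L : Link) (p : ℝ × ℝ) (hp : p ∈ L.tradeoffCurve) :
    ∃ (F : L.Policy) (th : ℤ → Fin (L.A + 1) → ℤ) (sStar : Fin L.S) (aStar : Fin (L.A + 1)),
      F.IsThreshold th sStar aStar ∧
      (∃ π, F.IsStationary π ∧
        L.avgPower (F.freq π) = p.1 ∧ L.avgDelay (F.freq π) = p.2) ∧
      (L.IsDelayOptimal p →
        (∀ z : L.State, F.HasPower z p.1 ∧ F.HasDelay z p.2) ∧
        (∀ (G : L.Policy) (z : L.State) (P' D' : ℝ),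
          G.HasPower z P' → G.HasDelay z D' → P' ≤ p.1 → p.2 ≤ D')) := by
  obtain ⟨lam, hlam, hmin, hpos⟩ := Link.exists_minimizes hp
  obtain ⟨F, ⟨th, sStar, aStar, hth⟩, hπ, hall⟩ := hmin.exists_threshold hlam
  refine ⟨F, th, sStar, aStar, hth, hπ, fun hopt => ⟨fun z => ⟨?_, ?_⟩, ?_⟩⟩
  · exact Markov.tendsto_average_of_forall_stationary F.trans_mem_rowStochastic
      (fun π h1 h2 => (hall (hpos hopt) π ⟨h1, h2⟩).1) z
  · exact Link.Policy.hasDelay_iff.2 (Markov.tendsto_average_of_forall_stationary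
      F.trans_mem_rowStochastic (fun π h1 h2 => (hall (hpos hopt) π ⟨h1, h2⟩).2) z)
  · intro G z P' D' hP hD hle
    exact hopt.2 _ (Link.Policy.mem_obtainable hP hD) hle
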